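/- All locally compact groups are Hausdorff. Let $B,H$ be locally compact groups, $A\subsetneq B$ a compact open subgroup, and $L\le H$ an open subgroup. Put $X=H/L$ with base point $\xi=L$. **The wreath product.** Let $B^{X,A}$ be the group of functions $X\to B$ with all but finitely many values in $A$, with the group topology in which $A^X$ (product topology) is an open subgroup. Let $G=B\wr^A_{H/L}H=B^{X,A}\rtimes H$, where $(h\cdot f)(x)=f(h^{-1}x)$, with the product topology. **The group $G_0$.** Let $\Pi=\{f\in B^X: f(X\smallsetminus\{\xi\})\subset A\}$ and let $$G_0=(\Pi\rtimes L)\ast_{A^X\rtimes L}(A^X\rtimes H)$$ be the amalgam of these subgroups of $G$ over their intersection, with the finest group topology for which the inclusions of both factors are continuous. Let $\pi:G_0\to G$ be the homomorphism mapping both factors identically. **The subgroups $N_g$.** Identify $b\in B$ with the function equal to $b$ at $\xi$ and to $1$ elsewhere; thus $B$ and $H$ map to $G_0$. For $g\in H$ let $N_g$ be the normal subgroup of $G_0$ generated by $[gBg^{-1},B]$. It depends only on the class of $g$ for the equivalence relation "$g_1\in Lg_2L$ or $g_1\in Lg_2^{-1}L$". Let $Q$ be the quotient of $H$ by this relation and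 $Q^*=Q\smallsetminus\{L\}$. **Definitions.** A family $(N_i)_{i\in I}$ of closed normal subgroups of a locally compact group is *independent* if no $N_i$ is contained in the closed subgroup generated by the $N_j$, $j\ne i$. A locally compact group is *compactly presented* if, as an abstract group, it has a presentation whose generating set is a compact subset and whose relators have bounded length. A compactly generated locally compact group $\Gamma$ is *INIP* (infinitely independently presented) if for some, and for every, compactly presented locally compact group $P$ with a quotient map $P\twoheadrightarrow\Gamma$ with discrete kernel, the kernel is generated by an infinite independent family of normal subgroups of $P$. It is *largely related* if for every continuous epimorphism $P\twoheadrightarrow\Gamma$ with discrete kernel from a compactly presented locally compact group $P$, the kernel admits a non-abelian free quotient. **Proposition.** (1) $G_0$ is a locally compact group, $\pi$ is an open continuous surjection with discrete kernel, $\ker\pi$ is generated by the $N_g$ ($g\in Q^*$), and the family $(N_g)_{g\in Q^*}$ of closed normal subgroups of $G_0$ is independent. (2) If moreover the double coset space $L\backslash H/L$ is infinite and $B$ and $H$ are compactly generated, then $G$ is a compactly generated locally compact group which is INIP and largely related. -/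

import Mathlib

open Filter Topology

universe u v w

/-! ### Locally compact groups, presentations, independence -/

/-- Locally compact group: a Hausdorff locally compact topological group. -/
structure IsLCGroup (G : Type w) [Group G] [TopologicalSpace G] : Prop where
  isTopologicalGroup : IsTopologicalGroup G
  locallyCompactSpace : LocallyCompactSpace G
  t2Space : T2Space G

/-- Some compact subset generates `G` as an abstract group. -/
def IsCompactlyGeneratedGroup (G : Type w) [Group G] [TopologicalSpace G] : Prop :=
  ∃ K : Set G, IsCompact K ∧ Subgroup.closure K = ⊤

/-- CGLC group: compactly generated locally compact group. -/
structure IsCGLCGroup (G : Type w) [Group G] [TopologicalSpace G] : Prop extends IsLCGroup G where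
  compactlyGenerated : IsCompactlyGeneratedGroup G

/-- Compactly presented locally compact group: for some compact generating subset `K` of `G`, the
group `G` is presented, as an abstract group, by the generators `K` and a set `R` of relators of
bounded length. -/
structure IsCompactlyPresented (G : Type w) [Group G] [TopologicalSpace G] : Prop
    extends IsLCGroup G where
  exists_presentation : ∃ K : Set G, IsCompact K ∧ Subgroup.closure K = ⊤ ∧
    ∃ (n : ℕ) (R : Set (FreeGroup K)),
      (∀ r ∈ R, ∃ l : List (K × Bool), l.length ≤ n ∧ FreeGroup.mk l = r) ∧
      Subgroup.normalClosure R = (FreeGroup.lift (fun k : K => (k : G))).ker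

/-- A family of closed normal subgroups is independent if no `N i` is contained in the closed
subgroup generated by the `N j`, `j ≠ i`. -/
structure IsIndependentFamily {G : Type w} [Group G] [TopologicalSpace G] {ι : Type*}
    (N : ι → Subgroup G) : Prop where
  normal : ∀ i, (N i).Normal
  isClosed : ∀ i, IsClosed (N i : Set G)
  not_subset : ∀ i, ¬ ((N i : Set G) ⊆ closure ((⨆ (j) (_ : j ≠ i), N j : Subgroup G) : Set G))

/-- `D` is generated by an infinite independent family of normal subgroups of the ambient group. -/
def IsInfinitelyIndependentlyGenerated {G : Type w} [Group G] [TopologicalSpace G]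
    (D : Subgroup G) : Prop :=
  ∃ (ι : Type w) (N : ι → Subgroup G), Infinite ι ∧ IsIndependentFamily N ∧ ⨆ i, N i = D

/-- Infinitely independently presented CGLC groups. The condition on the kernel is required both
for some and for every compactly presented group with a quotient map with discrete kernel. -/
structure IsINIP (G : Type w) [Group G] [TopologicalSpace G] : Prop extends IsCGLCGroup G where
  exists_cover : ∃ (P : Type w) (_ : Group P) (_ : TopologicalSpace P) (π : P →* G),
    IsCompactlyPresented P ∧ IsOpenQuotientMap π ∧ DiscreteTopology π.ker ∧
      IsInfinitelyIndependentlyGenerated π.ker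
  forall_cover : ∀ (P : Type w) [Group P] [TopologicalSpace P] (π : P →* G),
    IsCompactlyPresented P → IsOpenQuotientMap π → DiscreteTopology π.ker →
      IsInfinitelyIndependentlyGenerated π.ker

/-- Some quotient of `K` is a non-abelian free group. -/
def HasNonabelianFreeQuotient (K : Type w) [Group K] : Prop :=
  ∃ (ι : Type) (f : K →* FreeGroup ι), Nontrivial ι ∧ Function.Surjective f

/-- Largely related CGLC groups. -/
structure IsLargelyRelated (G : Type w) [Group G] [TopologicalSpace G] : Prop
    extends IsCGLCGroup G where
  forall_cover : ∀ (P : Type w) [Group P] [TopologicalSpace P] (π : P →* G),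
    IsCompactlyPresented P → Continuous π → Function.Surjective π → DiscreteTopology π.ker →
      HasNonabelianFreeQuotient π.ker

/-! ### Semirestricted wreath products -/

namespace SemirestrictedWreath

open scoped commutatorElement

variable {B : Type u} {H : Type v} [Group B] [Group H]

/-- The semirestricted power `B^{X,A}`: functions `X → B` with all but finitely many values in `A`.
Its topology (from Mathlib) is the group topology for which `A^X` is open and has the product
topology. -/
abbrev Power (A : Subgroup B) (X : Type v) : Type (max u v) :=
  RestrictedProduct (fun _ : X => B) (fun _ : X => (A : Set B)) cofinite

/-- The action of `h` on `B^{X,A}`: `(h • f) x = f (h⁻¹ • x)`. -/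
def shiftFun (A : Subgroup B) {X : Type v} [MulAction H X] (h : H) (f : Power A X) : Power A X :=
  ⟨fun x => f (h⁻¹ • x), (MulAction.injective h⁻¹).tendsto_cofinite.eventually f.eventually⟩

/-- The action of `H` on `B^{X,A}` by group automorphisms. -/
def shift (A : Subgroup B) (X : Type v) [MulAction H X] : H →* MulAut (Power A X) where
  toFun h :=
    { toFun := shiftFun A h
      invFun := shiftFun A h⁻¹
      left_inv := fun f => RestrictedProduct.ext _ _ fun x => by
        change f (h⁻¹ • (h⁻¹)⁻¹ • x) = f x
        simp
      right_inv := fun f => RestrictedProduct.ext _ _ fun x => by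
        change f ((h⁻¹)⁻¹ • h⁻¹ • x) = f x
        simp
      map_mul' := fun _ _ => rfl }
  map_one' := by
    ext f x
    change f ((1 : H)⁻¹ • x) = f x
    simp
  map_mul' a b := by
    ext f x
    change f ((a * b)⁻¹ • x) = f (b⁻¹ • a⁻¹ • x)
    simp [mul_smul]

/-- The semirestricted wreath product `B^{X,A} ⋊ H` for `X = H ⧸ L`. -/
abbrev Wreath (A : Subgroup B) (L : Subgroup H) : Type (max u v) :=
  SemidirectProduct (Power A (H ⧸ L)) H (shift A (H ⧸ L))

/-- The semirestricted wreath product carries the product topology. -/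
instance [TopologicalSpace B] [TopologicalSpace H] (A : Subgroup B) (L : Subgroup H) :
    TopologicalSpace (Wreath A L) :=
  TopologicalSpace.induced (fun g => (g.left, g.right)) inferInstance

variable (A : Subgroup B) (L : Subgroup H)

/-- The base point of `H ⧸ L`. -/
abbrev basePt : H ⧸ L := ((1 : H) : H ⧸ L)

theorem left_mul_apply (g k : Wreath A L) (x : H ⧸ L) :
    (g * k).left x = g.left x * k.left (g.right⁻¹ • x) := rfl

theorem left_inv_apply (g : Wreath A L) (x : H ⧸ L) :
    (g⁻¹).left x = (g.left (g.right • x))⁻¹ := by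
  change (g.left ((g.right⁻¹)⁻¹ • x))⁻¹ = _
  rw [inv_inv]

theorem smul_basePt {h : H} (hh : h ∈ L) : h • basePt L = basePt L := by
  change ((h * 1 : H) : H ⧸ L) = _
  rw [QuotientGroup.eq]
  simpa using hh

/-- The unrestricted wreath product `A^{H/L} ⋊ H`, as a subgroup of the semirestricted one. -/
def unrestricted : Subgroup (Wreath A L) where
  carrier := {g | ∀ x, g.left x ∈ A}
  one_mem' := fun _ => A.one_mem
  mul_mem' := fun {g k} hg hk x => by
    rw [left_mul_apply]
    exact A.mul_mem (hg x) (hk _)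
  inv_mem' := fun {g} hg x => by
    rw [left_inv_apply]
    exact A.inv_mem (hg _)

/-- The subgroup `Π ⋊ L` of the semirestricted wreath product, where `Π` is the set of functions
with values in `A` outside the base point. -/
def pointed : Subgroup (Wreath A L) where
  carrier := {g | g.right ∈ L ∧ ∀ x, x ≠ basePt L → g.left x ∈ A}
  one_mem' := ⟨L.one_mem, fun _ _ => A.one_mem⟩
  mul_mem' := fun {g k} hg hk => ⟨L.mul_mem hg.1 hk.1, fun x hx => by
    rw [left_mul_apply]
    refine A.mul_mem (hg.2 x hx) (hk.2 _ fun h => hx ?_)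
    rw [inv_smul_eq_iff, smul_basePt L hg.1] at h
    exact h⟩
  inv_mem' := fun {g} hg => ⟨L.inv_mem hg.1, fun x hx => by
    rw [left_inv_apply]
    refine A.inv_mem (hg.2 _ fun h => hx ?_)
    rw [← eq_inv_smul_iff, smul_basePt L (L.inv_mem hg.1)] at h
    exact h⟩

/-- The two factors of the amalgam. -/
def factor : Bool → Subgroup (Wreath A L)
  | false => pointed A L
  | true => unrestricted A L

/-- The amalgamated subgroup `A^{H/L} ⋊ L`, the intersection of the two factors. -/
def common : Subgroup (Wreath A L) := pointed A L ⊓ unrestricted A L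

theorem common_le (i : Bool) : common A L ≤ factor A L i := by
  cases i
  · exact inf_le_left
  · exact inf_le_right

/-- The inclusion of the amalgamated subgroup into a factor. -/
def commonHom (i : Bool) : common A L →* factor A L i := Subgroup.inclusion (common_le A L i)

/-- The amalgam `G₀` of `Π ⋊ L` and `A^{H/L} ⋊ H` over `A^{H/L} ⋊ L`. -/
def Cover : Type (max u v) := Monoid.PushoutI (commonHom A L)

instance : Group (Cover A L) := Monoid.PushoutI.instGroup (φ := commonHom A L)

/-- The inclusion of a factor into `G₀`. -/
def factorHom (i : Bool) : factor A L i →* Cover A L :=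
  Monoid.PushoutI.of (φ := commonHom A L) i

/-- `G₀` carries the finest group topology for which the inclusions of both factors are
continuous. -/
instance [TopologicalSpace B] [TopologicalSpace H] : TopologicalSpace (Cover A L) :=
  (sInf {t : GroupTopology (Cover A L) |
    ∀ i, @Continuous _ _ _ t.toTopologicalSpace (factorHom A L i)}).toTopologicalSpace

/-- The homomorphism from `G₀` to the semirestricted wreath product that maps both factors
identically. -/
def proj : Cover A L →* Wreath A L :=
  Monoid.PushoutI.lift (φ := commonHom A L) (fun i => (factor A L i).subtype) (common A L).subtype fun _ => rfl

open Classical in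
theorem mulSingle_mem_pointed (b : B) :
    (SemidirectProduct.inl (RestrictedProduct.mulSingle (fun _ => A) (basePt L) b) :
      Wreath A L) ∈ factor A L false := by
  refine ⟨L.one_mem, fun x hx => ?_⟩
  change RestrictedProduct.mulSingle (fun _ => A) (basePt L) b x ∈ A
  rw [RestrictedProduct.mulSingle_eq_of_ne _ _ hx]
  exact A.one_mem

open Classical in
/-- The copy of `b : B` in `G₀`: the function on `H ⧸ L` with value `b` at the base point and `1`
elsewhere, in the first factor. -/
noncomputable def ofB (b : B) : Cover A L :=
  factorHom A L false ⟨SemidirectProduct.inl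
    (RestrictedProduct.mulSingle (fun _ => A) (basePt L) b), mulSingle_mem_pointed A L b⟩

theorem inr_mem_unrestricted (h : H) :
    (SemidirectProduct.inr h : Wreath A L) ∈ factor A L true :=
  fun _ => A.one_mem

/-- The copy of `H` in `G₀`, through the second factor. -/
def ofH : H →* Cover A L :=
  (factorHom A L true).comp
    ((SemidirectProduct.inr : H →* Wreath A L).codRestrict (factor A L true)
      (inr_mem_unrestricted A L))

/-- The normal subgroup `N_g` of `G₀` generated by `[g B g⁻¹, B]`. -/
noncomputable def relSubgroup (g : H) : Subgroup (Cover A L) :=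
  Subgroup.normalClosure
    {c | ∃ b b' : B, c = ⁅ofH A L g * ofB A L b * (ofH A L g)⁻¹, ofB A L b'⁆}

/-- The equivalence relation on `H`: `g₁` lies in the same `L`-double coset as `g₂` or `g₂⁻¹`. -/
def simSetoid : Setoid H where
  r g₁ g₂ := g₁ ∈ DoubleCoset.doubleCoset g₂ (L : Set H) L ∨
    g₁ ∈ DoubleCoset.doubleCoset g₂⁻¹ (L : Set H) L
  iseqv :=
    { refl := fun g => Or.inl (DoubleCoset.mem_doubleCoset_self L L g)
      symm := by
        simp only [DoubleCoset.mem_doubleCoset]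
        rintro x y (⟨a, ha, b, hb, rfl⟩ | ⟨a, ha, b, hb, rfl⟩)
        · exact Or.inl ⟨a⁻¹, L.inv_mem ha, b⁻¹, L.inv_mem hb, by group⟩
        · exact Or.inr ⟨b, hb, a, ha, by group⟩
      trans := by
        simp only [DoubleCoset.mem_doubleCoset]
        rintro x y z (⟨a, ha, b, hb, rfl⟩ | ⟨a, ha, b, hb, rfl⟩)
          (⟨c, hc, d, hd, rfl⟩ | ⟨c, hc, d, hd, rfl⟩)
        · exact Or.inl ⟨a * c, L.mul_mem ha hc, d * b, L.mul_mem hd hb, by group⟩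
        · exact Or.inr ⟨a * c, L.mul_mem ha hc, d * b, L.mul_mem hd hb, by group⟩
        · exact Or.inr ⟨a * d⁻¹, L.mul_mem ha (L.inv_mem hd), c⁻¹ * b,
            L.mul_mem (L.inv_mem hc) hb, by group⟩
        · exact Or.inl ⟨a * d⁻¹, L.mul_mem ha (L.inv_mem hd), c⁻¹ * b,
            L.mul_mem (L.inv_mem hc) hb, by group⟩ }

/-- `Q`, the quotient of `H` by this relation. -/
abbrev Q : Type v := Quotient (simSetoid L)

/-- `Q* = Q ∖ {L}`. -/
abbrev QStar : Type v := {q : Q L // q ≠ Quotient.mk (simSetoid L) 1}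

/-- The copies of `L` and `B` in `G₀` commute. -/
theorem ofH_mul_ofB {l : H} (hl : l ∈ L) (b : B) :
    ofH A L l * ofB A L b = ofB A L b * ofH A L l := by
  have hmem : (SemidirectProduct.inr l : Wreath A L) ∈ common A L :=
    ⟨⟨hl, fun _ _ => A.one_mem⟩, fun _ => A.one_mem⟩
  have h1 : ofH A L l = factorHom A L false ⟨_, common_le A L false hmem⟩ :=
    (Monoid.PushoutI.of_apply_eq_base (φ := commonHom A L) true
      ⟨_, hmem⟩).trans
      (Monoid.PushoutI.of_apply_eq_base (φ := commonHom A L) false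
        ⟨_, hmem⟩).symm
  rw [h1, ofB, ← map_mul, ← map_mul]
  congr 1
  apply Subtype.ext
  refine SemidirectProduct.ext (RestrictedProduct.ext _ _ fun x => ?_) ?_
  · classical
    change (1 : B) * RestrictedProduct.mulSingle (fun _ => A) (basePt L) b (l⁻¹ • x) =
      RestrictedProduct.mulSingle (fun _ => A) (basePt L) b x * 1
    rw [one_mul, mul_one]
    by_cases hx : x = basePt L
    · subst hx
      rw [smul_basePt L (L.inv_mem hl)]
    · rw [RestrictedProduct.mulSingle_eq_of_ne _ _ hx, RestrictedProduct.mulSingle_eq_of_ne]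
      intro h
      rw [inv_smul_eq_iff, smul_basePt L hl] at h
      exact hx h
  · change l * 1 = 1 * l
    rw [one_mul, mul_one]

theorem relSubgroup_le_mul {g l l' : H} (hl : l ∈ L) (hl' : l' ∈ L) :
    relSubgroup A L (l * g * l') ≤ relSubgroup A L g := by
  have hN : (relSubgroup A L g).Normal := Subgroup.normalClosure_normal
  apply Subgroup.normalClosure_le_normal
  rintro _ ⟨b, b', rfl⟩
  have e1 : ofH A L (l * g * l') * ofB A L b * (ofH A L (l * g * l'))⁻¹ =
      ofH A L l * (ofH A L g * ofB A L b * (ofH A L g)⁻¹) * (ofH A L l)⁻¹ := by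
    have := ofH_mul_ofB A L hl' b
    simp only [map_mul, mul_inv_rev, mul_assoc]
    rw [← mul_assoc (ofH A L l'), this]
    group
  have e2 : ofB A L b' = ofH A L l * ofB A L b' * (ofH A L l)⁻¹ := by
    rw [ofH_mul_ofB A L hl b', mul_inv_cancel_right]
  rw [e1, e2, ← conjugate_commutatorElement]
  exact hN.conj_mem _ (Subgroup.subset_normalClosure ⟨b, b', rfl⟩) _

theorem relSubgroup_inv_le (g : H) : relSubgroup A L g⁻¹ ≤ relSubgroup A L g := by
  have hN : (relSubgroup A L g).Normal := Subgroup.normalClosure_normal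
  apply Subgroup.normalClosure_le_normal
  rintro _ ⟨b, b', rfl⟩
  have e : ⁅ofH A L g⁻¹ * ofB A L b * (ofH A L g⁻¹)⁻¹, ofB A L b'⁆ =
      ofH A L g⁻¹ * ⁅ofH A L g * ofB A L b' * (ofH A L g)⁻¹, ofB A L b⁆⁻¹ *
        (ofH A L g⁻¹)⁻¹ := by
    rw [commutatorElement_inv]
    simp only [commutatorElement_def, map_inv]
    group
  rw [e]
  exact hN.conj_mem _
    (inv_mem (Subgroup.subset_normalClosure ⟨b', b, rfl⟩)) _

/-- `N_g` only depends on the class of `g` in `Q`. -/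
theorem relSubgroup_eq {g₁ g₂ : H} (h : (simSetoid L).r g₁ g₂) :
    relSubgroup A L g₁ = relSubgroup A L g₂ := by
  have key : ∀ x y : H, (simSetoid L).r x y → relSubgroup A L x ≤ relSubgroup A L y := by
    rintro x y (h | h) <;> obtain ⟨a, ha, b, hb, rfl⟩ := DoubleCoset.mem_doubleCoset.1 h
    · exact relSubgroup_le_mul A L ha hb
    · exact (relSubgroup_le_mul A L ha hb).trans (relSubgroup_inv_le A L y)
  exact le_antisymm (key _ _ h) (key _ _ ((simSetoid L).symm h))

/-- The family `(N_g)`, where `g` ranges over `Q*`. -/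
noncomputable def relFamily (q : QStar L) : Subgroup (Cover A L) :=
  Quotient.lift (relSubgroup A L) (fun _ _ h => relSubgroup_eq A L h) q.1

end SemirestrictedWreath

/-! Topology. Suppose a homomorphism to a topological group has a set-theoretic section that, near
the identity, is multiplicative and equivariant under conjugation. Then the images of neighbourhoods
of `1` form a neighbourhood basis of a group topology on the source. For it the map is continuous
and open with discrete kernel, and the source inherits local compactness and the Hausdorff property.
For `G₀` the section is the inclusion of the open subgroup `A^X ⋊ L`, and the topology obtained is
the finest one in question (`nhds_one_cover`).

Kernel. Modulo all `N_g` with `g ∉ L`, the copies of `B` at distinct points of `X` commute. A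
product of such elements is then determined by finitely many coordinates, and if these lie in `A`,
it lies in the image of `A^X ⋊ H`, where the projection is injective. So nothing of the kernel is
left (`eq_one_of_commute`).

Independence. Fix `g₁, g₂ ∉ L` and let `F` be free of rank two. The function `weight : G → F` is
invariant under left multiplication by `A^X ⋊ L`. Let `A^X ⋊ H` act on `F × G` by left translation
of `G`, and `Π ⋊ L` by translation conjugated by the shear `(x, w) ↦ (weight w * x, w)`. By
invariance the two actions agree on `A^X ⋊ L`, so `G₀` acts. Elements of `ker π` fix the
`G`-coordinate, and their effect on `F` over `1` is a homomorphism `kerHom : ker π → F`. It kills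
`N_g` unless `g` is equivalent to `g₁` or `g₂` (`relSubgroup_le_ker_shearAction`), whereas suitable
commutators go to inverses of free generators (`exists_mem_relSubgroup_kerHom_eq`). Hence no `N_g`
lies in the join of the others, and `ker π` maps onto `F` even after all but two classes are killed.

Arbitrary covers. Given a compactly presented `P` over `G`, lift a compact generating set to `G₀`.
The relators, of bounded length, land in a compact set, which meets the discrete kernel in a finite
set; so do the words comparing generators. Finitely many `N_g` contain this finite set in their join
`D`, and `P` maps onto `G₀ / D` over `G` (`IsCompactlyPresented.exists_hom_quotient`). As `Q*` is
infinite, infinitely many `N_g` remain and pull back to `P`, as does a homomorphism onto `F`. A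
compactly presented cover exists: take a compact generating neighbourhood of `1` with all its
relators of length at most four. -/

/-! ### Group topologies from local sections -/

/-- A map `s : G → P` which, near the identity, is a multiplicative section of `p : P →* G` and is
equivariant under conjugation. -/
structure IsLocalSection {P G : Type*} [Group P] [Group G] [TopologicalSpace G]
    (p : P →* G) (s : G → P) : Prop where
  map_one : s 1 = 1
  map_mul : ∀ᶠ z : G × G in 𝓝 1 ×ˢ 𝓝 1, s (z.1 * z.2) = s z.1 * s z.2
  conj : ∀ g : P, ∀ᶠ u in 𝓝 (1 : G), g * s u * g⁻¹ = s (p g * u * (p g)⁻¹)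
  right_inv : ∀ᶠ u in 𝓝 (1 : G), p (s u) = u

namespace IsLocalSection

variable {P G : Type*} [Group P] [Group G] [TopologicalSpace G] {p : P →* G} {s : G → P}

/-- The filter `map s (𝓝 1)` is itself a group filter basis: each axiom is the same fact about `𝓝 1`
transported by the matching local identity of `s`. Inverses come from multiplicativity at `(u,
u⁻¹)`. -/
theorem exists_topology [IsTopologicalGroup G] (hs : IsLocalSection p s) :
    ∃ t : TopologicalSpace P, IsTopologicalGroup P ∧ @nhds P t 1 = map s (𝓝 1) := by
  let b : GroupFilterBasis P :=
    { sets := (map s (𝓝 1)).sets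
      nonempty := ⟨_, univ_mem⟩
      inter_sets := fun {x y} hx hy => ⟨x ∩ y, inter_mem hx hy, subset_rfl⟩
      one' := fun {U} hU => by
        have := mem_of_mem_nhds (mem_map.1 hU)
        rwa [Set.mem_preimage, hs.map_one] at this
      mul' := fun {U} hU => by
        have h1 : Tendsto (fun z : G × G => z.1 * z.2) (𝓝 1 ×ˢ 𝓝 1) (𝓝 1) := by
          rw [← nhds_prod_eq]
          exact tendsto_mul.trans (by simp)
        obtain ⟨V, hV, hVU⟩ := mem_prod_same_iff.1 (hs.map_mul.and (h1 (mem_map.1 hU)))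
        refine ⟨s '' V, image_mem_map hV, ?_⟩
        rintro _ ⟨_, ⟨x, hx, rfl⟩, _, ⟨y, hy, rfl⟩, rfl⟩
        have := hVU (Set.mk_mem_prod hx hy)
        change s x * s y ∈ U
        rw [← this.1]
        exact this.2
      inv' := fun {U} hU => by
        have h1 : Tendsto (fun u : G => u⁻¹) (𝓝 1) (𝓝 1) := by
          simpa using tendsto_inv (1 : G)
        have h2 := (tendsto_id.prodMk h1).eventually hs.map_mul
        refine ⟨s '' {u | s (u * u⁻¹) = s u * s u⁻¹ ∧ s u⁻¹ ∈ U},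
          image_mem_map (h2.and (h1 (mem_map.1 hU))), ?_⟩
        rintro _ ⟨u, ⟨h, h'⟩, rfl⟩
        rw [mul_inv_cancel, hs.map_one] at h
        change (s u)⁻¹ ∈ U
        rwa [← eq_inv_of_mul_eq_one_right h.symm]
      conj' := fun g {U} hU => by
        have h1 : Tendsto (fun u : G => p g * u * (p g)⁻¹) (𝓝 1) (𝓝 1) := by
          have : Continuous fun u : G => p g * u * (p g)⁻¹ := by fun_prop
          simpa using this.tendsto 1
        refine ⟨s '' {u | g * s u * g⁻¹ = s (p g * u * (p g)⁻¹) ∧ s (p g * u * (p g)⁻¹) ∈ U},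
          image_mem_map ((hs.conj g).and (h1 (mem_map.1 hU))), ?_⟩
        rintro _ ⟨u, ⟨h, h'⟩, rfl⟩
        change g * s u * g⁻¹ ∈ U
        rwa [h] }
  refine ⟨b.topology, b.isTopologicalGroup, ?_⟩
  rw [b.nhds_one_eq]
  ext U
  exact ⟨fun ⟨V, hV, hVU⟩ => mem_of_superset hV hVU, fun hU => ⟨U, hU, subset_rfl⟩⟩

variable [TopologicalSpace P] [IsTopologicalGroup P] [IsTopologicalGroup G]

omit [IsTopologicalGroup P] [IsTopologicalGroup G] in
theorem map_nhds_one (hs : IsLocalSection p s) (hn : 𝓝 (1 : P) = map s (𝓝 1)) :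
    map p (𝓝 1) = 𝓝 1 := by
  rw [hn, map_map]
  exact (map_congr hs.right_inv).trans map_id

theorem continuous (hs : IsLocalSection p s) (hn : 𝓝 (1 : P) = map s (𝓝 1)) : Continuous p :=
  continuous_of_continuousAt_one p (by
    rw [ContinuousAt, _root_.map_one]
    exact (hs.map_nhds_one hn).le)

theorem isOpenMap (hs : IsLocalSection p s) (hn : 𝓝 (1 : P) = map s (𝓝 1)) : IsOpenMap p :=
  IsTopologicalGroup.isOpenMap_iff_nhds_one.2 (hs.map_nhds_one hn).ge

-- Elements near `1` have the form `s u` with `p (s u) = u`, so such an element of the kernel is `s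
-- 1`.
omit [IsTopologicalGroup P] [IsTopologicalGroup G] in
theorem eventually_eq_one (hs : IsLocalSection p s) (hn : 𝓝 (1 : P) = map s (𝓝 1)) :
    ∀ᶠ k in 𝓝 (1 : P), p k = 1 → k = 1 := by
  rw [hn, eventually_map]
  filter_upwards [hs.right_inv] with u hu h
  rw [hu] at h
  rw [h, hs.map_one]

omit [IsTopologicalGroup G] in
theorem discreteTopology_ker (hs : IsLocalSection p s) (hn : 𝓝 (1 : P) = map s (𝓝 1)) :
    DiscreteTopology p.ker := by
  apply discreteTopology_of_isOpen_singleton_one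
  rw [isOpen_singleton_iff_nhds_eq_pure, nhds_subtype, OneMemClass.coe_one]
  refine le_antisymm ?_ fun U hU => ?_
  swap
  · obtain ⟨V, hV, hVU⟩ := mem_comap.1 hU
    exact hVU (show (1 : P) ∈ V from mem_of_mem_nhds hV)
  rw [le_pure_iff, mem_comap]
  exact ⟨_, hs.eventually_eq_one hn, fun k hk => Subtype.ext (hk k.2)⟩

theorem t2Space [T2Space G] (hs : IsLocalSection p s) (hn : 𝓝 (1 : P) = map s (𝓝 1)) :
    T2Space P := by
  rw [IsTopologicalGroup.t2Space_iff_one_closed]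
  have hc : IsClosed (p.ker : Set P) := isClosed_singleton.preimage (hs.continuous hn)
  have hd := hs.discreteTopology_ker hn
  have : IsClosed (((↑) : p.ker → P) '' {1}) :=
    hc.isClosedEmbedding_subtypeVal.isClosedMap _ (isClosed_discrete _)
  simpa using this

/-- Local multiplicativity `s v = s u * s (u⁻¹ * v)` spreads the continuity of `s` from `1` to a
neighbourhood, so `s` carries a small compact neighbourhood of `1` to a compact one. -/
theorem locallyCompactSpace [LocallyCompactSpace G] (hs : IsLocalSection p s)
    (hn : 𝓝 (1 : P) = map s (𝓝 1)) : LocallyCompactSpace P := by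
  obtain ⟨V, hV, hVs⟩ := mem_prod_same_iff.1 hs.map_mul
  have hcont : ∀ u ∈ interior V, ContinuousAt s u := by
    intro u hu
    have h1 : Tendsto (fun v => u⁻¹ * v) (𝓝 u) (𝓝 1) := by
      have : Continuous fun v : G => u⁻¹ * v := by fun_prop
      simpa using this.tendsto u
    have h2 : Tendsto (fun v => s u * s (u⁻¹ * v)) (𝓝 u) (𝓝 (s u * 1)) :=
      tendsto_const_nhds.mul ((hn ▸ tendsto_map : Tendsto s (𝓝 1) (𝓝 1)).comp h1)
    rw [mul_one] at h2
    refine h2.congr' ?_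
    filter_upwards [h1 hV] with v hv
    have := hVs (Set.mk_mem_prod (interior_subset hu) hv)
    simpa using this.symm
  obtain ⟨K, hK, hKV, hKc⟩ := local_compact_nhds (interior_mem_nhds.2 hV)
  refine (hKc.image_of_continuousOn fun u hu =>
    (hcont u (hKV hu)).continuousWithinAt).locallyCompactSpace_of_mem_nhds_of_group (x := 1) ?_
  rw [hn]
  exact image_mem_map hK

theorem isLCGroup (hG : IsLCGroup G) (hs : IsLocalSection p s)
    (hn : 𝓝 (1 : P) = map s (𝓝 1)) : IsLCGroup P :=
  have := hG.2
  have := hG.3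
  ⟨inferInstance, hs.locallyCompactSpace hn, hs.t2Space hn⟩

end IsLocalSection

namespace SemirestrictedWreath

variable {B : Type u} {H : Type v} [Group B] [Group H] [TopologicalSpace B] [TopologicalSpace H]

/-! ### The semirestricted wreath product is a locally compact group -/

theorem isOpen_setOf_inv_smul_eq [IsTopologicalGroup H] {L : Subgroup H}
    (hL : IsOpen (L : Set H)) (x y : H ⧸ L) : IsOpen {h : H | h⁻¹ • x = y} := by
  have := QuotientGroup.discreteTopology hL
  have hc : Continuous fun h : H => h⁻¹ • x := by fun_prop
  exact (isOpen_discrete {y}).preimage hc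

/-- It suffices to treat functions with values in `A` on a fixed cofinite set `S`. For `h` near
`h₀`, the translates by `h` all lie in the piece attached to the translate of `S` by `h₀`, whose
topology is that of coordinatewise convergence. -/
theorem continuous_shiftFun [IsTopologicalGroup H] {A : Subgroup B} (hA : IsOpen (A : Set B))
    {L : Subgroup H} (hL : IsOpen (L : Set H)) :
    Continuous fun p : H × Power A (H ⧸ L) => shiftFun A p.1 p.2 := by
  rw [RestrictedProduct.continuous_dom_prod_left fun _ => hA]
  intro S hS
  have hfin : Sᶜ.Finite := le_principal_iff.1 hS
  rw [continuous_iff_continuousAt]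
  rintro ⟨h₀, f₀⟩
  have hS' : cofinite ≤ 𝓟 {x | h₀⁻¹ • x ∈ S} :=
    le_principal_iff.2 ((MulAction.injective h₀⁻¹).tendsto_cofinite (le_principal_iff.1 hS))
  -- Elements of `V` move the finitely many exceptional points exactly as `h₀` does. The set is open
  -- since `H ⧸ L` is discrete.
  let V : Set H := ⋂ y ∈ Sᶜ, {h | h⁻¹ • (h₀ • y) = y}
  have hV : IsOpen V := hfin.isOpen_biInter fun y _ => isOpen_setOf_inv_smul_eq hL _ _
  have h₀V : h₀ ∈ V := by simp [V]
  have hVS : ∀ h ∈ V, ∀ x, h₀⁻¹ • x ∈ S → h⁻¹ • x ∈ S := by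
    intro h hh x hx
    by_contra hc
    have h1 : h⁻¹ • (h₀ • (h⁻¹ • x)) = h⁻¹ • x := Set.mem_iInter₂.1 hh _ hc
    have h2 : h₀ • (h⁻¹ • x) = x := MulAction.injective h⁻¹ h1
    rw [← h2, inv_smul_smul] at hx
    exact hc hx
  refine ContinuousOn.continuousAt (s := V ×ˢ Set.univ) ?_
    ((hV.prod isOpen_univ).mem_nhds ⟨h₀V, trivial⟩)
  rw [continuousOn_iff_continuous_domRestrict]
  let F : (V ×ˢ Set.univ : Set (H × RestrictedProduct (fun _ : H ⧸ L => B)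
      (fun _ => (A : Set B)) (𝓟 S))) →
      RestrictedProduct (fun _ : H ⧸ L => B) (fun _ => (A : Set B)) (𝓟 {x | h₀⁻¹ • x ∈ S}) :=
    fun p => ⟨fun x => p.1.2 (p.1.1⁻¹ • x), fun x hx => p.1.2.2 (hVS _ p.2.1 _ hx)⟩
  have hF : Continuous F := by
    rw [RestrictedProduct.continuous_rng_of_principal_iff_forall]
    intro x
    rw [continuous_iff_continuousAt]
    intro p
    have h1 : ContinuousAt (fun q : (V ×ˢ Set.univ : Set (H × RestrictedProduct
        (fun _ : H ⧸ L => B) (fun _ => (A : Set B)) (𝓟 S))) => q.1.2 (p.1.1⁻¹ • x)) p :=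
      ((RestrictedProduct.continuous_eval _).comp
        (continuous_snd.comp continuous_subtype_val)).continuousAt
    refine h1.congr ?_
    have h2 := ((isOpen_setOf_inv_smul_eq hL x (p.1.1⁻¹ • x)).preimage
      (continuous_fst.comp continuous_subtype_val)).mem_nhds (x := p) rfl
    filter_upwards [h2] with q hq
    change q.1.2 (p.1.1⁻¹ • x) = q.1.2 (q.1.1⁻¹ • x)
    rw [show q.1.1⁻¹ • x = p.1.1⁻¹ • x from hq]
  exact (RestrictedProduct.continuous_inclusion hS').comp hF

variable (A : Subgroup B) (L : Subgroup H)

theorem isInducing_prod : IsInducing fun g : Wreath A L => (g.left, g.right) := ⟨rfl⟩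

theorem continuous_left : Continuous fun g : Wreath A L => g.left :=
  continuous_fst.comp (isInducing_prod A L).continuous

theorem continuous_right : Continuous fun g : Wreath A L => g.right :=
  continuous_snd.comp (isInducing_prod A L).continuous

/-- The wreath product is, as a topological space, a product. -/
def homeomorphProd : Wreath A L ≃ₜ Power A (H ⧸ L) × H :=
  SemidirectProduct.equivProd.toHomeomorphOfIsInducing (isInducing_prod A L)

variable {A L}

theorem isTopologicalGroup_wreath [IsTopologicalGroup B] [IsTopologicalGroup H]
    (hA : IsOpen (A : Set B)) (hL : IsOpen (L : Set H)) : IsTopologicalGroup (Wreath A L) := by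
  have : Fact (∀ _ : H ⧸ L, IsOpen (A : Set B)) := ⟨fun _ => hA⟩
  have hs := continuous_shiftFun hA hL
  refine { continuous_mul := ?_, continuous_inv := ?_ }
  · rw [(isInducing_prod A L).continuous_iff]
    have h1 := (continuous_left A L).comp (continuous_fst (Y := Wreath A L))
    have h2 := (continuous_left A L).comp (continuous_snd (X := Wreath A L))
    have h3 := (continuous_right A L).comp (continuous_fst (Y := Wreath A L))
    have h4 := (continuous_right A L).comp (continuous_snd (X := Wreath A L))
    exact (h1.mul (hs.comp (h3.prodMk h2))).prodMk (h3.mul h4)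
  · rw [(isInducing_prod A L).continuous_iff]
    have h1 := continuous_left A L
    have h2 := continuous_right A L
    exact (hs.comp (h2.inv.prodMk h1.inv)).prodMk h2.inv

theorem isLCGroup_wreath [IsTopologicalGroup B] [IsTopologicalGroup H] [LocallyCompactSpace B]
    [LocallyCompactSpace H] [T2Space B] [T2Space H] (hAc : IsCompact (A : Set B))
    (hA : IsOpen (A : Set B)) (hL : IsOpen (L : Set H)) : IsLCGroup (Wreath A L) := by
  have : Fact (∀ _ : H ⧸ L, IsOpen (A : Set B)) := ⟨fun _ => hA⟩
  have : CompactSpace A := isCompact_iff_compactSpace.1 hAc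
  exact ⟨isTopologicalGroup_wreath hA hL,
    (homeomorphProd A L).isOpenEmbedding.locallyCompactSpace,
    (homeomorphProd A L).symm.t2Space⟩

/-- The amalgamated subgroup is open in the wreath product. -/
theorem isOpen_common (hA : IsOpen (A : Set B)) (hL : IsOpen (L : Set H)) :
    IsOpen (common A L : Set (Wreath A L)) := by
  have h1 : IsOpen {g : Wreath A L | ∀ x, g.left x ∈ A} :=
    (RestrictedProduct.isOpen_forall_mem (fun _ : H ⧸ L => hA)).preimage (continuous_left A L)
  have h2 : IsOpen {g : Wreath A L | g.right ∈ L} := hL.preimage (continuous_right A L)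
  convert h1.inter h2 using 1
  ext g
  exact ⟨fun h => ⟨h.2, h.1.1⟩, fun h => ⟨⟨h.2, fun x _ => h.1 x⟩, h.1⟩⟩

/-- The compact group `A^X`, inside the wreath product. -/
theorem isCompact_setOf_forall_mem (hAc : IsCompact (A : Set B)) :
    IsCompact {g : Wreath A L | (∀ x, g.left x ∈ A) ∧ g.right = 1} := by
  have : CompactSpace A := isCompact_iff_compactSpace.1 hAc
  have h1 : IsCompact (Set.range (RestrictedProduct.structureMap (fun _ : H ⧸ L => B)
      (fun _ => (A : Set B)) cofinite)) :=
    haveI : CompactSpace ((A : Set B)) := this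
    isCompact_range RestrictedProduct.isEmbedding_structureMap.continuous
  have h2 := (homeomorphProd A L).isCompact_preimage.2
    (h1.prod (isCompact_singleton (x := (1 : H))))
  convert h2 using 1
  ext g
  rw [RestrictedProduct.range_structureMap]
  rfl

end SemirestrictedWreath

namespace SemirestrictedWreath

/-! ### The topology of the amalgam -/

section Algebra

variable {B : Type u} {H : Type v} [Group B] [Group H] (A : Subgroup B) (L : Subgroup H)

/-- The inclusion of the amalgamated subgroup into the amalgam. -/
def baseHom : common A L →* Cover A L := Monoid.PushoutI.base (commonHom A L)

variable {A L}

theorem factorHom_eq_baseHom (i : Bool) (k : factor A L i) (hk : (k : Wreath A L) ∈ common A L) :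
    factorHom A L i k = baseHom A L ⟨k, hk⟩ :=
  Monoid.PushoutI.of_apply_eq_base (commonHom A L) i ⟨k, hk⟩

theorem factorHom_commonHom (i : Bool) (c : common A L) :
    factorHom A L i (commonHom A L i c) = baseHom A L c :=
  Monoid.PushoutI.of_apply_eq_base (commonHom A L) i c

theorem proj_factorHom (i : Bool) (k : factor A L i) : proj A L (factorHom A L i k) = k :=
  Monoid.PushoutI.lift_of (φ := commonHom A L) _ _ _ _

theorem proj_baseHom (k : common A L) : proj A L (baseHom A L k) = k :=
  Monoid.PushoutI.lift_base (φ := commonHom A L) _ _ _ _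

@[elab_as_elim]
theorem Cover.induction_on {motive : Cover A L → Prop} (x : Cover A L)
    (of : ∀ (i : Bool) (k : factor A L i), motive (factorHom A L i k))
    (mul : ∀ x y, motive x → motive y → motive (x * y)) : motive x := by
  refine Monoid.PushoutI.induction_on (φ := commonHom A L) x of (fun h => ?_) mul
  have := of true (commonHom A L true h)
  rwa [factorHom_eq_baseHom true _ h.2] at this

variable (A L) in
open Classical in
/-- The inclusion of the amalgamated subgroup into the amalgam, extended by `1`. -/
noncomputable def localSection (u : Wreath A L) : Cover A L :=
  if h : u ∈ common A L then baseHom A L ⟨u, h⟩ else 1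

theorem localSection_of_mem {u : Wreath A L} (h : u ∈ common A L) :
    localSection A L u = baseHom A L ⟨u, h⟩ := dif_pos h

end Algebra

variable {B : Type u} {H : Type v} [Group B] [Group H] [TopologicalSpace B] [TopologicalSpace H]
  [IsTopologicalGroup B] [IsTopologicalGroup H] {A : Subgroup B} {L : Subgroup H}

/-- For `k` in one factor and `u` near `1`, both `u` and `k * u * k⁻¹` lie in the amalgamated
subgroup, so the conjugation takes place inside that factor. Products follow because conjugation in
the wreath product is continuous at `1`. -/
theorem isLocalSection (hA : IsOpen (A : Set B)) (hL : IsOpen (L : Set H)) :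
    IsLocalSection (proj A L) (localSection A L) := by
  have := isTopologicalGroup_wreath hA hL
  have hC : (common A L : Set (Wreath A L)) ∈ 𝓝 1 :=
    (isOpen_common hA hL).mem_nhds (one_mem _)
  have hconj : ∀ g : Wreath A L, Tendsto (fun u => g * u * g⁻¹) (𝓝 1) (𝓝 1) := by
    intro g
    have : Continuous fun u : Wreath A L => g * u * g⁻¹ := by fun_prop
    simpa using this.tendsto 1
  refine ⟨?_, ?_, fun g => ?_, ?_⟩
  · rw [localSection_of_mem (one_mem _)]
    exact map_one (baseHom A L)
  · filter_upwards [prod_mem_prod hC hC] with z hz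
    rw [localSection_of_mem hz.1, localSection_of_mem hz.2,
      localSection_of_mem (mul_mem hz.1 hz.2), ← map_mul]
    rfl
  · induction g using Cover.induction_on with
    | of i k =>
      filter_upwards [hC, hconj k hC] with u hu hu'
      have hu'' : (k : Wreath A L) * u * (k : Wreath A L)⁻¹ ∈ common A L := hu'
      let k' : factor A L i := ⟨u, common_le A L i hu⟩
      have h1 : factorHom A L i (k * k' * k⁻¹) = baseHom A L ⟨_, hu''⟩ :=
        factorHom_eq_baseHom i (k * k' * k⁻¹) hu''
      have h2 : factorHom A L i k' = baseHom A L ⟨u, hu⟩ := factorHom_eq_baseHom i k' hu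
      rw [proj_factorHom, localSection_of_mem hu, localSection_of_mem hu'', ← h1, ← h2, map_mul,
        map_mul, map_inv]
    | mul x y hx hy =>
      filter_upwards [hy, (hconj (proj A L y)).eventually hx] with u hu hu'
      rw [map_mul, mul_inv_rev, mul_inv_rev,
        show x * y * localSection A L u * (y⁻¹ * x⁻¹) = x * (y * localSection A L u * y⁻¹) * x⁻¹ by
          group, hu, hu']
      simp only [mul_assoc]
  · filter_upwards [hC] with u hu
    rw [localSection_of_mem hu, proj_baseHom]

instance : IsTopologicalGroup (Cover A L) :=
  (sInf {t : GroupTopology (Cover A L) |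
    ∀ i, @Continuous _ _ _ t.toTopologicalSpace (factorHom A L i)}).toIsTopologicalGroup

omit [IsTopologicalGroup B] [IsTopologicalGroup H] in
theorem continuous_factorHom (i : Bool) : Continuous (factorHom A L i) := by
  change @Continuous _ _ _ (sInf {t : GroupTopology (Cover A L) |
    ∀ i, @Continuous _ _ _ t.toTopologicalSpace (factorHom A L i)}).toTopologicalSpace _
  rw [GroupTopology.toTopologicalSpace_sInf, continuous_sInf_rng]
  rintro _ ⟨t, ht, rfl⟩
  exact ht i

theorem nhds_one_cover (hA : IsOpen (A : Set B)) (hL : IsOpen (L : Set H)) :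
    𝓝 (1 : Cover A L) = map (localSection A L) (𝓝 1) := by
  have := isTopologicalGroup_wreath hA hL
  have hC : (common A L : Set (Wreath A L)) ∈ 𝓝 1 :=
    (isOpen_common hA hL).mem_nhds (one_mem _)
  have hev : ∀ i, ∀ᶠ k : factor A L i in 𝓝 1,
      localSection A L (k : Wreath A L) = factorHom A L i k := by
    intro i
    have : Tendsto ((↑) : factor A L i → Wreath A L) (𝓝 1) (𝓝 1) :=
      continuous_subtype_val.tendsto 1
    filter_upwards [this hC] with k hk
    rw [localSection_of_mem hk, factorHom_eq_baseHom i k hk]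
  refine le_antisymm ?_ ?_
  -- The topology of the local section makes both inclusions continuous, so the finest such topology
  -- refines it.
  · obtain ⟨t, htg, ht⟩ := (isLocalSection hA hL).exists_topology
    rw [← ht]
    refine nhds_mono ?_
    let t' : GroupTopology (Cover A L) := ⟨t, htg⟩
    refine (sInf_le (a := t') ?_ : sInf {t : GroupTopology (Cover A L) |
      ∀ i, @Continuous _ _ _ t.toTopologicalSpace (factorHom A L i)} ≤ t')
    intro i
    refine continuous_of_continuousAt_one (factorHom A L i) ?_
    rw [ContinuousAt, map_one, ht]
    have h1 : Tendsto ((↑) : factor A L i → Wreath A L) (𝓝 1) (𝓝 1) :=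
      continuous_subtype_val.tendsto 1
    exact (tendsto_map.comp h1).congr' (hev i)
  -- Conversely, continuity on one open factor already makes the local section tend to `1` at `1`.
  · have ho : IsOpen (factor A L true : Set (Wreath A L)) :=
      Subgroup.isOpen_of_mem_nhds _ (mem_of_superset hC (common_le A L true))
    rw [show (1 : Wreath A L) = ((1 : factor A L true) : Wreath A L) from rfl,
      ← ho.isOpenEmbedding_subtypeVal.map_nhds_eq, map_map]
    have h2 : Tendsto (factorHom A L true) (𝓝 1) (𝓝 1) := by
      have := (continuous_factorHom (A := A) (L := L) true).tendsto 1
      rwa [map_one] at this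
    exact h2.congr' ((hev true).mono fun k hk => hk.symm)

/-! ### Generators of the amalgam and surjectivity of the projection -/

section Algebra

variable {B : Type u} {H : Type v} [Group B] [Group H] {A : Subgroup B} {L : Subgroup H}

theorem ofH_eq (h : H) : ofH A L h = factorHom A L true ⟨SemidirectProduct.inr h,
    inr_mem_unrestricted A L h⟩ := rfl

/-- Functions with values in `A`, in the unrestricted factor. -/
theorem inl_mem_common {f : Power A (H ⧸ L)} (hf : ∀ x, f x ∈ A) :
    (SemidirectProduct.inl f : Wreath A L) ∈ common A L :=
  ⟨⟨L.one_mem, fun x _ => hf x⟩, hf⟩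

theorem factorHom_true_eq (k : factor A L true) :
    factorHom A L true k = baseHom A L ⟨SemidirectProduct.inl (k : Wreath A L).left,
      inl_mem_common k.2⟩ * ofH A L (k : Wreath A L).right := by
  rw [← factorHom_eq_baseHom true ⟨_, (inl_mem_common k.2).2⟩, ofH_eq, ← map_mul]
  congr 1
  exact Subtype.ext (SemidirectProduct.inl_left_mul_inr_right _).symm

open Classical in
/-- Every element of the pointed factor is the product of a function supported at the base point
and an element of the amalgamated subgroup. -/
theorem factorHom_false_eq (k : factor A L false) :
    ∃ c : common A L, factorHom A L false k =
      ofB A L ((k : Wreath A L).left (basePt L)) * baseHom A L c := by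
  let s : Wreath A L := SemidirectProduct.inl
    (RestrictedProduct.mulSingle (fun _ => A) (basePt L) ((k : Wreath A L).left (basePt L)))
  have hs : s ∈ factor A L false := mulSingle_mem_pointed A L _
  have hc : s⁻¹ * k ∈ common A L := by
    have hsk : s⁻¹ * (k : Wreath A L) ∈ pointed A L := mul_mem (inv_mem hs) k.2
    refine ⟨hsk, fun x => ?_⟩
    by_cases hx : x = basePt L
    · subst hx
      change (RestrictedProduct.mulSingle (fun _ => A) (basePt L)
        ((k : Wreath A L).left (basePt L)) (((1 : H)⁻¹)⁻¹ • basePt L))⁻¹ *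
          (k : Wreath A L).left ((1 : H)⁻¹⁻¹ • basePt L) ∈ A
      simp [A.one_mem]
    · exact hsk.2 x hx
  refine ⟨⟨_, hc⟩, ?_⟩
  rw [← factorHom_eq_baseHom false ⟨_, hc.1⟩, ofB, ← map_mul]
  congr 1
  exact Subtype.ext (mul_inv_cancel_left s _).symm

theorem ofB_mul (b b' : B) : ofB A L (b * b') = ofB A L b * ofB A L b' := by
  classical
  rw [ofB, ofB, ofB, ← map_mul]
  congr 1
  refine Subtype.ext ?_
  change SemidirectProduct.inl _ = SemidirectProduct.inl _ * SemidirectProduct.inl _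
  rw [← map_mul, ← RestrictedProduct.mulSingle_mul]

variable (A L) in
/-- The copy of `B` at the base point, as a homomorphism. -/
noncomputable def ofBHom : B →* Cover A L := MonoidHom.mk' (ofB A L) ofB_mul

theorem ofBHom_apply (b : B) : ofBHom A L b = ofB A L b := rfl

open Classical in
theorem proj_ofB (b : B) : proj A L (ofB A L b) = SemidirectProduct.inl
    (RestrictedProduct.mulSingle (fun _ => A) (basePt L) b) := proj_factorHom _ _

theorem proj_ofH (h : H) : proj A L (ofH A L h) = SemidirectProduct.inr h := proj_factorHom _ _

/-- A function supported at the base point with value in `A` lies in the amalgamated subgroup. -/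
theorem ofB_mem_range_baseHom {b : B} (hb : b ∈ A) : ofB A L b ∈ (baseHom A L).range := by
  classical
  have : (SemidirectProduct.inl (RestrictedProduct.mulSingle (fun _ => A) (basePt L) b) :
      Wreath A L) ∈ common A L := by
    refine inl_mem_common fun x => ?_
    by_cases hx : x = basePt L
    · subst hx
      rwa [RestrictedProduct.mulSingle_eq_same]
    · rw [RestrictedProduct.mulSingle_eq_of_ne _ _ hx]
      exact A.one_mem
  exact ⟨⟨_, this⟩, (factorHom_eq_baseHom false ⟨_, this.1⟩ this).symm⟩

variable (A L) in
/-- `A^X` in the amalgam. -/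
def arrowSubgroup : Subgroup (Cover A L) :=
  ((SemidirectProduct.rightHom.comp (common A L).subtype).ker).map (baseHom A L)

-- No case for inverses is needed, since each of the three families is closed under inversion.
@[elab_as_elim]
theorem Cover.generator_induction {motive : Cover A L → Prop} (x : Cover A L)
    (ofB : ∀ b, motive (ofB A L b)) (ofH : ∀ h, motive (ofH A L h))
    (arrow : ∀ c ∈ arrowSubgroup A L, motive c)
    (mul : ∀ x y, motive x → motive y → motive (x * y)) : motive x := by
  have hbase : ∀ c : common A L, motive (baseHom A L c) := by
    intro c
    have h1 : (c : Wreath A L) ∈ factor A L true := c.2.2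
    have h2 := factorHom_true_eq ⟨_, h1⟩
    rw [factorHom_eq_baseHom true ⟨_, h1⟩ c.2] at h2
    rw [show c = ⟨(c : Wreath A L), c.2⟩ from rfl, h2]
    exact mul _ _ (arrow _ ⟨_, rfl, rfl⟩) (ofH _)
  induction x using Cover.induction_on with
  | of i k =>
    cases i
    · obtain ⟨c, hc⟩ := factorHom_false_eq k
      rw [hc]
      exact mul _ _ (ofB _) (hbase c)
    · rw [factorHom_true_eq]
      exact mul _ _ (hbase _) (ofH _)
  | mul x y hx hy => exact mul _ _ hx hy

theorem eq_top_of_generators_mem (S : Subgroup (Cover A L)) (hB : ∀ b, ofB A L b ∈ S)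
    (hH : ∀ h, ofH A L h ∈ S) (hA : arrowSubgroup A L ≤ S) : S = ⊤ :=
  eq_top_iff.2 fun x _ => Cover.generator_induction x hB hH hA fun _ _ hx hy => mul_mem hx hy

open Classical in
/-- Conjugating by `h` moves a function supported at the base point to `h • basePt`. -/
theorem inr_mul_inl_mulSingle_mul (h : H) (b : B) :
    (SemidirectProduct.inr h : Wreath A L) *
      SemidirectProduct.inl (RestrictedProduct.mulSingle (fun _ => A) (basePt L) b) *
      (SemidirectProduct.inr h)⁻¹ =
    SemidirectProduct.inl (RestrictedProduct.mulSingle (fun _ => A) ((h : H) : H ⧸ L) b) := by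
  rw [← map_inv, ← SemidirectProduct.inl_aut]
  congr 1
  refine RestrictedProduct.ext _ _ fun x => ?_
  change RestrictedProduct.mulSingle (fun _ => A) (basePt L) b (h⁻¹ • x) = _
  have hh : ((h : H) : H ⧸ L) = h • basePt L := by
    change _ = ((h * 1 : H) : H ⧸ L)
    rw [mul_one]
  by_cases hx : x = (h : H ⧸ L)
  · subst hx
    rw [RestrictedProduct.mulSingle_eq_same, hh, inv_smul_smul, RestrictedProduct.mulSingle_eq_same]
  · rw [RestrictedProduct.mulSingle_eq_of_ne _ _ hx, RestrictedProduct.mulSingle_eq_of_ne]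
    rwa [Ne, inv_smul_eq_iff, ← hh]

/-- A function takes values outside `A` at finitely many points. Dividing by functions supported at
one point, which are conjugates of elements of `B`, removes these points one at a time. -/
theorem proj_surjective : Function.Surjective (proj A L) := by
  classical
  rw [← MonoidHom.range_eq_top]
  have hH : ∀ h, (SemidirectProduct.inr h : Wreath A L) ∈ (proj A L).range :=
    fun h => ⟨_, proj_ofH h⟩
  have key : ∀ (T : Finset (H ⧸ L)) (f : Power A (H ⧸ L)), (∀ x ∉ T, f x ∈ A) →
      (SemidirectProduct.inl f : Wreath A L) ∈ (proj A L).range := by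
    intro T
    induction T using Finset.induction_on with
    | empty =>
      intro f hf
      exact ⟨_, proj_baseHom ⟨_, inl_mem_common fun x => hf x (Finset.notMem_empty x)⟩⟩
    | insert x T hx ih =>
      intro f hf
      obtain ⟨h, rfl⟩ := QuotientGroup.mk_surjective x
      let s := RestrictedProduct.mulSingle (fun _ => A) (h : H ⧸ L) (f (h : H ⧸ L))
      have h1 : (SemidirectProduct.inl s : Wreath A L) ∈ (proj A L).range := by
        rw [← inr_mul_inl_mulSingle_mul]
        exact mul_mem (mul_mem (hH _) ⟨_, proj_ofB _⟩) (inv_mem (hH _))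
      have h2 : (SemidirectProduct.inl (s⁻¹ * f) : Wreath A L) ∈ (proj A L).range := by
        refine ih _ fun y hy => ?_
        rw [RestrictedProduct.mul_apply, RestrictedProduct.inv_apply]
        by_cases hyx : y = h
        · subst hyx
          simp [s, A.one_mem]
        · simp only [s]
          rw [RestrictedProduct.mulSingle_eq_of_ne _ _ hyx, inv_one, one_mul]
          exact hf y (by simp [hyx, hy])
      rw [← mul_inv_cancel_left s f, map_mul]
      exact mul_mem h1 h2
  rw [eq_top_iff]
  rintro g -
  rw [← SemidirectProduct.inl_left_mul_inr_right g]
  have hfin : {x | g.left x ∉ A}.Finite := g.left.eventually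
  exact mul_mem (key hfin.toFinset _ fun x hx => by simpa using hx) (hH _)

end Algebra

/-! ### Openness of the projection and compact generation of the amalgam -/

theorem isOpenQuotientMap_proj (hA : IsOpen (A : Set B)) (hL : IsOpen (L : Set H)) :
    IsOpenQuotientMap (proj A L) :=
  have := isTopologicalGroup_wreath hA hL
  ⟨proj_surjective, (isLocalSection hA hL).continuous (nhds_one_cover hA hL),
    (isLocalSection hA hL).isOpenMap (nhds_one_cover hA hL)⟩

omit [IsTopologicalGroup H] in
theorem isCompactlyGeneratedGroup_cover (hAc : IsCompact (A : Set B)) (hA : IsOpen (A : Set B))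
    (hB : IsCompactlyGeneratedGroup B) (hH : IsCompactlyGeneratedGroup H) :
    IsCompactlyGeneratedGroup (Cover A L) := by
  obtain ⟨K, hK, hK'⟩ := hB
  obtain ⟨M, hM, hM'⟩ := hH
  -- Finitely many cosets `t A` cover `K`. The copy of `A` at the base point lies in the compact
  -- subgroup `A^X`, so only the representatives `t` have to be added as generators.
  obtain ⟨T, hT⟩ := hK.elim_finite_subcover (fun b : B => (b⁻¹ * ·) ⁻¹' (A : Set B))
    (fun b => hA.preimage (continuous_const_mul _))
    fun b _ => Set.mem_iUnion.2 ⟨b, by simp [A.one_mem]⟩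
  have hcH : Continuous (ofH A L) := by
    refine (continuous_factorHom true).comp (Continuous.subtype_mk ?_ _)
    rw [(isInducing_prod A L).continuous_iff]
    exact continuous_const.prodMk continuous_id
  have hcA : IsCompact (arrowSubgroup A L : Set (Cover A L)) := by
    have h1 : IsCompact {k : factor A L true | (k : Wreath A L).right = 1} := by
      rw [Subtype.isCompact_iff]
      convert isCompact_setOf_forall_mem (L := L) hAc using 1
      ext g
      exact ⟨fun ⟨k, hk, hkg⟩ => hkg ▸ ⟨k.2, hk⟩, fun hg => ⟨⟨g, hg.1⟩, hg.2, rfl⟩⟩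
    convert h1.image (continuous_factorHom true) using 1
    ext x
    constructor
    · rintro ⟨c, hc, rfl⟩
      exact ⟨⟨c, c.2.2⟩, hc, factorHom_eq_baseHom true ⟨_, c.2.2⟩ c.2⟩
    · rintro ⟨k, hk, rfl⟩
      have hk' : (k : Wreath A L).right = 1 := hk
      have hc : (k : Wreath A L) ∈ common A L :=
        ⟨⟨by rw [hk']; exact L.one_mem, fun x _ => k.2 x⟩, k.2⟩
      exact ⟨⟨k, hc⟩, hk, (factorHom_eq_baseHom true k hc).symm⟩
  refine ⟨ofB A L '' T ∪ (ofH A L '' M ∪ arrowSubgroup A L),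
    (T.finite_toSet.image _).isCompact.union ((hM.image hcH).union hcA),
    eq_top_of_generators_mem _ ?_ ?_ ?_⟩
  · set S := Subgroup.closure (ofB A L '' T ∪ (ofH A L '' M ∪ arrowSubgroup A L))
    have hAS : arrowSubgroup A L ≤ S :=
      fun x hx => Subgroup.subset_closure (Or.inr (Or.inr hx))
    suffices h : (⊤ : Subgroup B) ≤ S.comap (ofBHom A L) from fun b => h trivial
    rw [← hK', Subgroup.closure_le]
    intro b hb
    obtain ⟨t, ht, hbt⟩ := Set.mem_iUnion₂.1 (hT hb)
    have hbt' : t⁻¹ * b ∈ A := hbt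
    have h1 : ofB A L t ∈ S := Subgroup.subset_closure (Or.inl ⟨t, ht, rfl⟩)
    obtain ⟨c, hc⟩ := ofB_mem_range_baseHom (L := L) hbt'
    have h2 : ofB A L (t⁻¹ * b) ∈ S := by
      refine hAS ⟨c, ?_, hc⟩
      have h3 := congrArg (proj A L) hc
      rw [proj_baseHom, proj_ofB] at h3
      change (c : Wreath A L).right = 1
      rw [h3]
      rfl
    change ofB A L b ∈ S
    rw [← mul_inv_cancel_left t b, ofB_mul]
    exact mul_mem h1 h2
  · set S := Subgroup.closure (ofB A L '' T ∪ (ofH A L '' M ∪ arrowSubgroup A L))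
    suffices h : (⊤ : Subgroup H) ≤ S.comap (ofH A L) from fun b => h trivial
    rw [← hM', Subgroup.closure_le]
    exact fun h hh => Subgroup.subset_closure (Or.inr (Or.inl ⟨h, hh, rfl⟩))
  · exact fun x hx => Subgroup.subset_closure (Or.inr (Or.inr hx))

end SemirestrictedWreath

namespace SemirestrictedWreath

variable {B : Type u} {H : Type v} [Group B] [Group H] {A : Subgroup B} {L : Subgroup H}

/-! ### Generators of the kernel -/

variable (A L) in
/-- The element of the amalgam that corresponds to the function with value `b` at `h • basePt`. -/
noncomputable def single (h : H) (b : B) : Cover A L := ofH A L h * ofB A L b * (ofH A L h)⁻¹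

theorem single_mul (h : H) (b b' : B) :
    single A L h (b * b') = single A L h b * single A L h b' := by
  simp only [single, ofB_mul]
  group

theorem single_one (h : H) : single A L h 1 = 1 := by
  have := single_mul (A := A) (L := L) h 1 1
  rw [mul_one] at this
  exact left_eq_mul.1 this

theorem single_inv (h : H) (b : B) : single A L h b⁻¹ = (single A L h b)⁻¹ := by
  rw [eq_inv_iff_mul_eq_one, ← single_mul, inv_mul_cancel, single_one]

theorem single_congr {h h' : H} (hh : (h : H ⧸ L) = h') (b : B) :
    single A L h b = single A L h' b := by
  have hl : h⁻¹ * h' ∈ L := QuotientGroup.eq.1 hh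
  have h1 := ofH_mul_ofB A L hl b
  rw [single, single, ← mul_inv_cancel_left h h', map_mul (ofH A L) h, mul_inv_rev,
    mul_assoc (ofH A L h) (ofH A L (h⁻¹ * h')), h1]
  group

theorem ofH_mul_single_mul (g h : H) (b : B) :
    ofH A L g * single A L h b * (ofH A L g)⁻¹ = single A L (g * h) b := by
  simp only [single, map_mul]
  group

open Classical in
theorem proj_single (h : H) (b : B) : proj A L (single A L h b) =
    SemidirectProduct.inl (RestrictedProduct.mulSingle (fun _ => A) (h : H ⧸ L) b) := by
  rw [single, map_mul, map_mul, map_inv, proj_ofB, proj_ofH, inr_mul_inl_mulSingle_mul]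

theorem ofH_mul_arrow_mul (h : H) {c : Cover A L} (hc : c ∈ arrowSubgroup A L) :
    ofH A L h * c * (ofH A L h)⁻¹ ∈ arrowSubgroup A L := by
  obtain ⟨c, hc, rfl⟩ := hc
  have hc' : (c : Wreath A L).right = 1 := hc
  let k : factor A L true := ⟨_, inr_mem_unrestricted A L h⟩
  let m : factor A L true := k * commonHom A L true c * k⁻¹
  have hr : (m : Wreath A L).right = 1 := by
    change h * (c : Wreath A L).right * h⁻¹ = 1
    rw [hc', mul_one, mul_inv_cancel]
  have hm : (m : Wreath A L) ∈ common A L := ⟨⟨by rw [hr]; exact L.one_mem, fun x _ => m.2 x⟩, m.2⟩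
  refine ⟨⟨_, hm⟩, hr, ?_⟩
  rw [← factorHom_eq_baseHom true m hm, map_mul, map_mul, map_inv, factorHom_commonHom]
  rfl

theorem arrow_mul_ofB_mul {c : Cover A L} (hc : c ∈ arrowSubgroup A L) (b : B) :
    ∃ b', c * ofB A L b * c⁻¹ = ofB A L b' := by
  classical
  obtain ⟨c, hc, rfl⟩ := hc
  have hc' : (c : Wreath A L).right = 1 := hc
  let a := (c : Wreath A L).left (basePt L)
  refine ⟨a * b * a⁻¹, ?_⟩
  rw [← factorHom_commonHom false, ofB, ofB, ← map_mul, ← map_inv, ← map_mul]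
  congr 1
  refine Subtype.ext (SemidirectProduct.ext (RestrictedProduct.ext _ _ fun x => ?_) ?_)
  · change (c : Wreath A L).left x * RestrictedProduct.mulSingle (fun _ => A) (basePt L) b
      ((c : Wreath A L).right⁻¹ • x) * ((c : Wreath A L).left
        ((c : Wreath A L).right⁻¹⁻¹ • ((c : Wreath A L).right * 1)⁻¹ • x))⁻¹ =
        RestrictedProduct.mulSingle (fun _ => A) (basePt L) (a * b * a⁻¹) x
    simp only [hc', mul_one, inv_one, one_smul]
    by_cases hx : x = basePt L
    · subst hx
      rw [RestrictedProduct.mulSingle_eq_same, RestrictedProduct.mulSingle_eq_same]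
    · rw [RestrictedProduct.mulSingle_eq_of_ne _ _ hx, RestrictedProduct.mulSingle_eq_of_ne _ _ hx,
        mul_one, mul_inv_cancel]
  · change (c : Wreath A L).right * 1 * ((c : Wreath A L).right)⁻¹ = 1
    group

/-! ### Quotients of the amalgam in which copies of `B` at distinct points commute -/

section Quotient

variable {Q : Type w} [Group Q] (q : Cover A L →* Q) (r : Q →* Wreath A L)

/-- The subgroup generated by the images of the functions supported at one of the points of `T`. -/
def singleSubgroup (T : Set (H ⧸ L)) : Subgroup Q :=
  Subgroup.closure {y | ∃ (h : H) (b : B), (h : H ⧸ L) ∈ T ∧ q (single A L h b) = y}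

variable {q r}

theorem singleSubgroup_mono {S T : Set (H ⧸ L)} (h : S ⊆ T) :
    singleSubgroup q S ≤ singleSubgroup q T :=
  Subgroup.closure_mono fun _ ⟨k, b, hk, hb⟩ => ⟨k, b, h hk, hb⟩

theorem exists_finset_mem_singleSubgroup {y : Q} (hy : y ∈ singleSubgroup q Set.univ) :
    ∃ T : Finset (H ⧸ L), y ∈ singleSubgroup q (T : Set (H ⧸ L)) := by
  classical
  induction hy using Subgroup.closure_induction with
  | mem y hy =>
    obtain ⟨h, b, -, rfl⟩ := hy
    exact ⟨{(h : H ⧸ L)}, Subgroup.subset_closure ⟨h, b, by simp, rfl⟩⟩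
  | one => exact ⟨∅, one_mem _⟩
  | mul x y _ _ hx hy =>
    obtain ⟨S, hS⟩ := hx
    obtain ⟨T, hT⟩ := hy
    exact ⟨S ∪ T, mul_mem (singleSubgroup_mono (by simp) hS) (singleSubgroup_mono (by simp) hT)⟩
  | inv x _ hx =>
    obtain ⟨S, hS⟩ := hx
    exact ⟨S, inv_mem hS⟩

/-- Generators of the amalgam permute the functions supported at one point: `H` moves the point,
`A^X` conjugates the value, and `B` belongs to the subgroup. -/
theorem normal_singleSubgroup_univ (hq : Function.Surjective q) :
    (singleSubgroup q Set.univ).Normal := by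
  have key : ∀ (g : Cover A L), ∀ n ∈ singleSubgroup q Set.univ,
      q g * n * (q g)⁻¹ ∈ singleSubgroup q Set.univ := by
    intro g
    have hgen : ∀ g : Cover A L, (∀ h b, q (g * single A L h b * g⁻¹) ∈
        singleSubgroup q Set.univ) → ∀ n ∈ singleSubgroup q Set.univ,
        q g * n * (q g)⁻¹ ∈ singleSubgroup q Set.univ := by
      intro g hg
      suffices singleSubgroup q Set.univ ≤
          (singleSubgroup q Set.univ).comap (MulAut.conj (q g)).toMonoidHom from this
      rw [singleSubgroup, Subgroup.closure_le]
      rintro _ ⟨h, b, -, rfl⟩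
      have := hg h b
      rwa [map_mul, map_mul, map_inv] at this
    have hs : ∀ h b, q (single A L h b) ∈ singleSubgroup q Set.univ :=
      fun h b => Subgroup.subset_closure ⟨h, b, trivial, rfl⟩
    induction g using Cover.generator_induction with
    | ofB b =>
      have h1 : q (ofB A L b) ∈ singleSubgroup q Set.univ := by
        have := hs 1 b
        rwa [single, map_one, one_mul, inv_one, mul_one] at this
      exact fun n hn => mul_mem (mul_mem h1 hn) (inv_mem h1)
    | ofH h =>
      refine hgen _ fun k b => ?_
      rw [ofH_mul_single_mul]
      exact hs _ _
    | arrow c hc =>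
      refine hgen _ fun k b => ?_
      -- Move the point `k` back to the base point, where conjugation by `A^X` acts on the value
      -- alone.
      have h1 := ofH_mul_arrow_mul k⁻¹ hc
      obtain ⟨b', hb'⟩ := arrow_mul_ofB_mul h1 b
      have h2 : c * single A L k b * c⁻¹ = single A L k b' := by
        rw [single, single, ← hb', map_inv]
        group
      rw [h2]
      exact hs _ _
    | mul x y hx hy =>
      intro n hn
      rw [map_mul, mul_inv_rev, show q x * q y * n * ((q y)⁻¹ * (q x)⁻¹) =
        q x * (q y * n * (q y)⁻¹) * (q x)⁻¹ by group]
      exact hx _ (hy _ hn)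
  refine ⟨fun n hn g => ?_⟩
  obtain ⟨g, rfl⟩ := hq g
  exact key g n hn

theorem right_eq_one_of_mem_singleSubgroup (hr : ∀ x, r (q x) = proj A L x) {T : Set (H ⧸ L)}
    {x : H ⧸ L} (hx : x ∉ T) {y : Q} (hy : y ∈ singleSubgroup q T) :
    (r y).right = 1 ∧ (r y).left x = 1 := by
  classical
  induction hy using Subgroup.closure_induction with
  | mem y hy =>
    obtain ⟨h, b, hT, rfl⟩ := hy
    rw [hr, proj_single]
    refine ⟨rfl, RestrictedProduct.mulSingle_eq_of_ne _ _ ?_⟩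
    rintro rfl
    exact hx hT
  | one => rw [map_one]; exact ⟨rfl, rfl⟩
  | mul y z _ _ hy hz =>
    rw [map_mul, left_mul_apply, SemidirectProduct.mul_right, hy.1, hy.2, hz.1, inv_one, one_smul,
      hz.2]
    simp
  | inv y _ hy =>
    rw [map_inv, left_inv_apply, SemidirectProduct.inv_right, hy.1, one_smul, hy.2]
    simp

/-- Conjugating by `h'` reduces to the case where the second point is the base point. -/
theorem commute_single {h h' : H} (hh : (h : H ⧸ L) ≠ h')
    (hcomm : ∀ g ∉ L, ∀ b b', Commute (q (single A L g b)) (q (ofB A L b'))) (b b' : B) :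
    Commute (q (single A L h b)) (q (single A L h' b')) := by
  have hL : h'⁻¹ * h ∉ L := fun hc => hh (QuotientGroup.eq.2 hc).symm
  have h1 := (Commute.conj_iff (q (ofH A L h'))).2 (hcomm _ hL b b')
  rw [← map_inv, ← map_mul, ← map_mul, ← map_mul, ← map_mul, ofH_mul_single_mul,
    mul_inv_cancel_left] at h1
  exact h1

theorem exists_eq_single_mul {h : H} {T : Set (H ⧸ L)} (hT : (h : H ⧸ L) ∉ T)
    (hcomm : ∀ g ∉ L, ∀ b b', Commute (q (single A L g b)) (q (ofB A L b')))
    {y : Q} (hy : y ∈ singleSubgroup q (insert (h : H ⧸ L) T)) :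
    ∃ b, ∃ z ∈ singleSubgroup q T, y = q (single A L h b) * z := by
  have hc : ∀ b, ∀ z ∈ singleSubgroup q T, q (single A L h b) * z = z * q (single A L h b) := by
    intro b z hz
    induction hz using Subgroup.closure_induction with
    | mem z hz =>
      obtain ⟨k, b', hk, rfl⟩ := hz
      exact (commute_single (fun hh => hT (hh ▸ hk)) hcomm b' b).symm
    | one => simp
    | mul x y _ _ hx hy => exact (Commute.mul_right hx hy : Commute _ _)
    | inv x _ hx => exact (Commute.inv_right hx : Commute _ _)
  induction hy using Subgroup.closure_induction with
  | mem y hy =>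
    obtain ⟨k, b, hk, rfl⟩ := hy
    rcases hk with hk | hk
    · exact ⟨b, 1, one_mem _, by rw [mul_one, single_congr hk]⟩
    · exact ⟨1, _, Subgroup.subset_closure ⟨k, b, hk, rfl⟩, by rw [single_one, map_one, one_mul]⟩
  | one => exact ⟨1, 1, one_mem _, by rw [single_one, map_one, one_mul]⟩
  | mul y z _ _ hy hz =>
    obtain ⟨b, y', hy', rfl⟩ := hy
    obtain ⟨c, z', hz', rfl⟩ := hz
    refine ⟨b * c, y' * z', mul_mem hy' hz', ?_⟩
    rw [single_mul, map_mul, mul_assoc, mul_assoc, ← mul_assoc y', ← hc c y' hy', mul_assoc]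
  | inv y _ hy =>
    obtain ⟨b, y', hy', rfl⟩ := hy
    refine ⟨b⁻¹, y'⁻¹, inv_mem hy', ?_⟩
    rw [hc b y' hy', mul_inv_rev, single_inv, map_inv]

/-- Split off the points of `T` one by one. The value split off at a point is the coordinate of `r
y` there, so it belongs to `A`, and the corresponding factor comes from the unrestricted factor. -/
theorem mem_range_of_mem_singleSubgroup (hr : ∀ x, r (q x) = proj A L x)
    (hcomm : ∀ g ∉ L, ∀ b b', Commute (q (single A L g b)) (q (ofB A L b')))
    (T : Finset (H ⧸ L)) {y : Q} (hy : y ∈ singleSubgroup q (T : Set (H ⧸ L)))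
    (hy' : r y ∈ unrestricted A L) : y ∈ (q.comp (factorHom A L true)).range := by
  classical
  induction T using Finset.induction_on generalizing y with
  | empty =>
    have : y = 1 := by simpa [singleSubgroup] using hy
    rw [this]
    exact one_mem _
  | insert x T hx ih =>
    obtain ⟨h, rfl⟩ := QuotientGroup.mk_surjective x
    rw [Finset.coe_insert] at hy
    obtain ⟨b, z, hz, rfl⟩ := exists_eq_single_mul (by simpa using hx) hcomm hy
    have hz1 := right_eq_one_of_mem_singleSubgroup hr (by simpa using hx) hz
    have hb : b ∈ A := by
      have := hy' (h : H ⧸ L)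
      rw [map_mul, hr, proj_single, left_mul_apply] at this
      change RestrictedProduct.mulSingle (fun _ => A) (h : H ⧸ L) b (h : H ⧸ L) *
        (r z).left ((1 : H)⁻¹ • (h : H ⧸ L)) ∈ A at this
      rwa [RestrictedProduct.mulSingle_eq_same, inv_one, one_smul, hz1.2, mul_one] at this
    have hs : q (single A L h b) ∈ (q.comp (factorHom A L true)).range := by
      obtain ⟨c, hc⟩ := ofB_mem_range_baseHom (L := L) hb
      let k : factor A L true := ⟨_, inr_mem_unrestricted A L h⟩
      refine ⟨k * commonHom A L true c * k⁻¹, ?_⟩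
      simp only [MonoidHom.comp_apply, map_mul, map_inv, factorHom_commonHom, single, ← hc]
      rfl
    have hs' : r (q (single A L h b)) ∈ unrestricted A L := by
      obtain ⟨k, hk⟩ := hs
      rw [← hk, MonoidHom.comp_apply, hr, proj_factorHom]
      exact k.2
    refine mul_mem hs (ih hz ?_)
    rw [map_mul] at hy'
    exact (Subgroup.mul_mem_cancel_left _ hs').1 hy'

/-- Write `y = m * g` with `m` a product of functions supported at single points and `g` from the
unrestricted factor. If `r y = 1`, then `r m` has values in `A`, so `m` also comes from that factor,
on which the projection is injective. -/
theorem eq_one_of_commute (hq : Function.Surjective q) (hr : ∀ x, r (q x) = proj A L x)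
    (hcomm : ∀ g ∉ L, ∀ b b', Commute (q (single A L g b)) (q (ofB A L b')))
    {y : Q} (hy : r y = 1) : y = 1 := by
  have hN := normal_singleSubgroup_univ hq
  have htop : (singleSubgroup q Set.univ ⊔ (q.comp (factorHom A L true)).range).comap q = ⊤ := by
    refine eq_top_of_generators_mem _ (fun b => ?_) (fun h => ?_) ?_
    · refine Subgroup.mem_sup_left (Subgroup.subset_closure ⟨1, b, trivial, ?_⟩)
      rw [single, map_one, one_mul, inv_one, mul_one]
    · exact Subgroup.mem_sup_right ⟨_, rfl⟩
    · rintro _ ⟨c, -, rfl⟩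
      refine Subgroup.mem_sup_right ⟨commonHom A L true c, ?_⟩
      rw [MonoidHom.comp_apply, factorHom_commonHom]
  have hmem : y ∈ singleSubgroup q Set.univ ⊔ (q.comp (factorHom A L true)).range := by
    obtain ⟨x, rfl⟩ := hq y
    exact (htop ▸ Subgroup.mem_top x : x ∈ Subgroup.comap q _)
  obtain ⟨m, hm, g, ⟨k, rfl⟩, rfl⟩ := Subgroup.mem_sup_of_normal_left.1 hmem
  have hk : r (q.comp (factorHom A L true) k) = k := by
    rw [MonoidHom.comp_apply, hr, proj_factorHom]
  have hm' : r m ∈ unrestricted A L := by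
    rw [map_mul, hk] at hy
    rw [eq_inv_of_mul_eq_one_left hy]
    exact inv_mem k.2
  obtain ⟨T, hT⟩ := exists_finset_mem_singleSubgroup hm
  obtain ⟨k', hk'⟩ := mem_range_of_mem_singleSubgroup hr hcomm T hT hm'
  rw [← hk', ← map_mul] at hy ⊢
  rw [MonoidHom.comp_apply, hr, proj_factorHom] at hy
  rw [show k' * k = 1 from Subtype.ext hy, map_one]

end Quotient

/-! ### The kernel of the projection as the join of the relation subgroups -/

open Classical in
variable (A L) in
/-- The function on `H ⧸ L` with value `b` at `h • basePt`, in the wreath product. -/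
noncomputable def wreathSingle (h : H) (b : B) : Wreath A L :=
  SemidirectProduct.inl (RestrictedProduct.mulSingle (fun _ => A) (h : H ⧸ L) b)

theorem wreathSingle_mul_comm {h h' : H} (hh : (h : H ⧸ L) ≠ h') (b b' : B) :
    wreathSingle A L h b * wreathSingle A L h' b' =
      wreathSingle A L h' b' * wreathSingle A L h b := by
  classical
  rw [wreathSingle, wreathSingle, ← map_mul, ← map_mul]
  congr 1
  refine RestrictedProduct.ext _ _ fun x => ?_
  rw [RestrictedProduct.mul_apply, RestrictedProduct.mul_apply]
  by_cases hx : x = (h' : H ⧸ L)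
  · have : x ≠ (h : H ⧸ L) := fun h => hh (h.symm.trans hx)
    rw [RestrictedProduct.mulSingle_eq_of_ne _ _ this, one_mul, mul_one]
  · rw [RestrictedProduct.mulSingle_eq_of_ne (i := (h' : H ⧸ L)) _ _ hx, one_mul, mul_one]

theorem mk_ne_basePt {h : H} (hh : h ∉ L) : (h : H ⧸ L) ≠ ((1 : H) : H ⧸ L) := fun hc =>
  hh (by simpa using QuotientGroup.eq.1 hc)

open scoped commutatorElement

theorem relSubgroup_le_ker {g : H} (hg : g ∉ L) : relSubgroup A L g ≤ (proj A L).ker := by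
  apply Subgroup.normalClosure_le_normal
  rintro _ ⟨b, b', rfl⟩
  change proj A L ⁅single A L g b, ofB A L b'⁆ = 1
  rw [map_commutatorElement, proj_single, proj_ofB, commutatorElement_eq_one_iff_mul_comm]
  exact wreathSingle_mul_comm (mk_ne_basePt hg) b b'

theorem ker_proj_le (N : Subgroup (Cover A L)) [N.Normal] (hN : N ≤ (proj A L).ker)
    (h : ∀ g ∉ L, relSubgroup A L g ≤ N) : (proj A L).ker ≤ N := by
  intro x hx
  rw [← QuotientGroup.eq_one_iff]
  refine eq_one_of_commute (q := QuotientGroup.mk' N) (r := QuotientGroup.lift N (proj A L) hN)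
    (QuotientGroup.mk'_surjective N) (fun _ => rfl) ?_ hx
  intro g hg b b'
  have h1 : ⁅single A L g b, ofB A L b'⁆ ∈ N :=
    h g hg (Subgroup.subset_normalClosure ⟨b, b', rfl⟩)
  rw [← commutatorElement_eq_one_iff_commute, ← map_commutatorElement]
  exact (QuotientGroup.eq_one_iff _).2 h1

theorem mk_eq_mk_one_iff {g : H} :
    Quotient.mk (simSetoid L) g = Quotient.mk (simSetoid L) 1 ↔ g ∈ L := by
  rw [Quotient.eq]
  change g ∈ DoubleCoset.doubleCoset 1 (L : Set H) L ∨
    g ∈ DoubleCoset.doubleCoset (1 : H)⁻¹ (L : Set H) L ↔ _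
  rw [inv_one, or_self, DoubleCoset.mem_doubleCoset]
  constructor
  · rintro ⟨x, hx, y, hy, rfl⟩
    exact mul_mem (mul_mem hx L.one_mem) hy
  · exact fun hg => ⟨g, hg, 1, L.one_mem, by group⟩

theorem normal_relFamily (i : QStar L) : (relFamily A L i).Normal := by
  obtain ⟨⟨g⟩, hg⟩ := i
  exact Subgroup.normalClosure_normal

theorem iSup_relFamily : ⨆ i, relFamily A L i = (proj A L).ker := by
  have hN := normal_relFamily (A := A) (L := L)
  refine le_antisymm (iSup_le ?_) (ker_proj_le _ (iSup_le ?_) fun g hg => ?_)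
  · rintro ⟨⟨g⟩, hg⟩
    exact relSubgroup_le_ker fun h => hg (mk_eq_mk_one_iff.2 h)
  · rintro ⟨⟨g⟩, hg⟩
    exact relSubgroup_le_ker fun h => hg (mk_eq_mk_one_iff.2 h)
  · exact le_iSup (relFamily A L) ⟨Quotient.mk _ g, fun h => hg (mk_eq_mk_one_iff.1 h)⟩

end SemirestrictedWreath

namespace SemirestrictedWreath

variable {B : Type u} {H : Type v} [Group B] [Group H] {A : Subgroup B} {L : Subgroup H}

/-! ### Homomorphisms from the kernel to a free group -/

theorem wreathSingle_left_same (h : H) (b : B) :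
    (wreathSingle A L h b).left (h : H ⧸ L) = b := by
  classical
  exact RestrictedProduct.mulSingle_eq_same (fun _ : H ⧸ L => A) _ _

theorem wreathSingle_left_of_ne {h : H} {x : H ⧸ L} (hx : x ≠ h) (b : B) :
    (wreathSingle A L h b).left x = 1 := by
  classical
  exact RestrictedProduct.mulSingle_eq_of_ne (fun _ : H ⧸ L => A) _ hx

theorem wreathSingle_mul_left (h : H) (b : B) (w : Wreath A L) (x : H ⧸ L) :
    (wreathSingle A L h b * w).left x = (wreathSingle A L h b).left x * w.left x := by
  rw [left_mul_apply]
  change _ * w.left ((1 : H)⁻¹ • x) = _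
  rw [inv_one, one_smul]

theorem wreathSingle_mul_right (h : H) (b : B) (w : Wreath A L) :
    (wreathSingle A L h b * w).right = w.right := one_mul _

theorem inr_mul_wreathSingle (g h : H) (b : B) :
    SemidirectProduct.inr g * wreathSingle A L h b =
      wreathSingle A L (g * h) b * SemidirectProduct.inr g := by
  have h1 := congrArg (proj A L) (ofH_mul_single_mul (A := A) (L := L) g h b)
  rw [map_mul, map_mul, map_inv, proj_ofH, proj_single, proj_single] at h1
  exact mul_inv_eq_iff_eq_mul.1 h1

open Classical in
/-- An element of the free group that records whether `w` takes values outside `A` both at the base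
point and at one of the points `w.right * g₁`, `w.right * g₂`. -/
noncomputable def weight (g₁ g₂ : H) (w : Wreath A L) : FreeGroup Bool :=
  if w.right ∈ L ∧ w.left (basePt L) ∉ A then
    if w.left ((w.right * g₁ : H) : H ⧸ L) ∉ A then FreeGroup.of true
    else if w.left ((w.right * g₂ : H) : H ⧸ L) ∉ A then FreeGroup.of false else 1
  else 1

theorem weight_of_right_notMem {g₁ g₂ : H} {w : Wreath A L} (hw : w.right ∉ L) :
    weight g₁ g₂ w = 1 := if_neg fun h => hw h.1

/-- Multiplying by `c` shifts coordinates by `c.right` and changes values by factors in `A`. As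
`c.right ∈ L`, the base point is fixed, and the tested points `w.right * g` are shifted along. This
is what makes `shearAction` well defined on the amalgam. -/
theorem weight_common_mul (g₁ g₂ : H) {c : Wreath A L} (hc : c ∈ common A L) (w : Wreath A L) :
    weight g₁ g₂ (c * w) = weight g₁ g₂ w := by
  have hL : c.right ∈ L := hc.1.1
  have h1 : (c * w).right ∈ L ↔ w.right ∈ L := Subgroup.mul_mem_cancel_left _ hL
  have h2 : ∀ x, (c * w).left (c.right • x) ∈ A ↔ w.left x ∈ A := by
    intro x
    rw [left_mul_apply, inv_smul_smul]
    exact Subgroup.mul_mem_cancel_left _ (hc.2 _)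
  have h3 : (c * w).left (basePt L) ∈ A ↔ w.left (basePt L) ∈ A := by
    rw [← h2, smul_basePt L hL]
  have h4 : ∀ g : H, (c * w).left (((c * w).right * g : H) : H ⧸ L) ∈ A ↔
      w.left ((w.right * g : H) : H ⧸ L) ∈ A := by
    intro g
    rw [← h2]
    change (c * w).left ((c.right * w.right * g : H) : H ⧸ L) ∈ A ↔
      (c * w).left ((c.right * (w.right * g) : H) : H ⧸ L) ∈ A
    rw [mul_assoc]
  classical
  exact if_congr (and_congr h1 (not_congr h3)) (if_congr (not_congr (h4 _)) rfl
    (if_congr (not_congr (h4 _)) rfl rfl)) rfl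

/-- When `w.right ∈ L`, the tested points other than the base point come from `L g₁ L` and `L g₂ L`,
so the value at `k` is never consulted. -/
theorem weight_wreathSingle_mul {g₁ g₂ k : H} (hk : k ∉ L)
    (h₁ : k ∉ DoubleCoset.doubleCoset g₁ (L : Set H) L)
    (h₂ : k ∉ DoubleCoset.doubleCoset g₂ (L : Set H) L) (b : B) (w : Wreath A L) :
    weight g₁ g₂ (wreathSingle A L k b * w) = weight g₁ g₂ w := by
  by_cases hw : w.right ∈ L
  swap
  · rw [weight_of_right_notMem hw, weight_of_right_notMem]
    rwa [wreathSingle_mul_right]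
  have key : ∀ x : H ⧸ L, x ≠ (k : H ⧸ L) →
      (wreathSingle A L k b * w).left x = w.left x := by
    intro x hx
    rw [wreathSingle_mul_left, wreathSingle_left_of_ne hx, one_mul]
  have key' : ∀ g : H, k ∉ DoubleCoset.doubleCoset g (L : Set H) L →
      ((w.right * g : H) : H ⧸ L) ≠ (k : H ⧸ L) := by
    intro g hg hc
    refine hg (DoubleCoset.mem_doubleCoset.2 ⟨w.right, hw, _, QuotientGroup.eq.1 hc, ?_⟩)
    group
  rw [weight, weight, wreathSingle_mul_right, key _ (mk_ne_basePt hk).symm, key _ (key' _ h₁),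
    key _ (key' _ h₂)]

variable (A L) in
/-- Left translation of the second coordinate. -/
def translation : Wreath A L →* Equiv.Perm (FreeGroup Bool × Wreath A L) where
  toFun g := (Equiv.refl _).prodCongr (Equiv.mulLeft g)
  map_one' := by ext x <;> simp
  map_mul' g h := by ext x <;> simp [mul_assoc]

variable (A L) in
/-- The shearing of `FreeGroup Bool × Wreath A L` by `weight`. -/
noncomputable def shear (g₁ g₂ : H) : Equiv.Perm (FreeGroup Bool × Wreath A L) where
  toFun x := (weight g₁ g₂ x.2 * x.1, x.2)
  invFun x := ((weight g₁ g₂ x.2)⁻¹ * x.1, x.2)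
  left_inv x := by simp
  right_inv x := by simp

variable (A L) in
/-- The action of the amalgam on `FreeGroup Bool × Wreath A L`: the unrestricted factor acts by
translations, and the pointed factor by translations conjugated by `shear`. -/
noncomputable def shearAction (g₁ g₂ : H) :
    Cover A L →* Equiv.Perm (FreeGroup Bool × Wreath A L) :=
  Monoid.PushoutI.lift (φ := commonHom A L)
    (fun i => match i with
      | false => (MulAut.conj (shear A L g₁ g₂)).toMonoidHom.comp
          ((translation A L).comp (factor A L false).subtype)
      | true => (translation A L).comp (factor A L true).subtype)
    ((translation A L).comp (common A L).subtype) (by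
      rintro (_ | _)
      · refine MonoidHom.ext fun c => Equiv.ext fun ⟨x, w⟩ => Prod.ext ?_ rfl
        change weight g₁ g₂ ((c : Wreath A L) * w) * ((weight g₁ g₂ w)⁻¹ * x) = x
        rw [weight_common_mul _ _ c.2, mul_inv_cancel_left]
      · rfl)

theorem shearAction_factorHom_true (g₁ g₂ : H) (k : factor A L true)
    (x : FreeGroup Bool × Wreath A L) :
    shearAction A L g₁ g₂ (factorHom A L true k) x = (x.1, k * x.2) :=
  congrArg (fun e : Equiv.Perm (FreeGroup Bool × Wreath A L) => e x)
    (Monoid.PushoutI.lift_of (φ := commonHom A L) _ _ _ _)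

theorem shearAction_factorHom_false (g₁ g₂ : H) (k : factor A L false)
    (x : FreeGroup Bool × Wreath A L) :
    shearAction A L g₁ g₂ (factorHom A L false k) x =
      (weight g₁ g₂ ((k : Wreath A L) * x.2) * ((weight g₁ g₂ x.2)⁻¹ * x.1),
        (k : Wreath A L) * x.2) :=
  congrArg (fun e : Equiv.Perm (FreeGroup Bool × Wreath A L) => e x)
    (Monoid.PushoutI.lift_of (φ := commonHom A L) _ _ _ _)

theorem shearAction_ofH (g₁ g₂ h : H) (x : FreeGroup Bool × Wreath A L) :
    shearAction A L g₁ g₂ (ofH A L h) x = (x.1, SemidirectProduct.inr h * x.2) :=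
  shearAction_factorHom_true _ _ _ _

theorem shearAction_ofB (g₁ g₂ : H) (b : B) (x : FreeGroup Bool × Wreath A L) :
    shearAction A L g₁ g₂ (ofB A L b) x =
      (weight g₁ g₂ (wreathSingle A L 1 b * x.2) * ((weight g₁ g₂ x.2)⁻¹ * x.1),
        wreathSingle A L 1 b * x.2) :=
  shearAction_factorHom_false _ _ _ _

theorem shearAction_single (g₁ g₂ g : H) (b : B) (x : FreeGroup Bool × Wreath A L) :
    shearAction A L g₁ g₂ (single A L g b) x =
      (weight g₁ g₂ (wreathSingle A L 1 b * (SemidirectProduct.inr g⁻¹ * x.2)) *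
        ((weight g₁ g₂ (SemidirectProduct.inr g⁻¹ * x.2))⁻¹ * x.1),
        wreathSingle A L g b * x.2) := by
  rw [single, ← map_inv, map_mul, map_mul, Equiv.Perm.mul_apply, Equiv.Perm.mul_apply,
    shearAction_ofH, shearAction_ofB, shearAction_ofH]
  congr 1
  dsimp only
  rw [← mul_assoc, inr_mul_wreathSingle, mul_assoc, ← mul_assoc (SemidirectProduct.inr g),
    ← map_mul]
  simp

/-- The action covers left translation of the wreath product and commutes with right translation of
the free group. Hence over `w = 1` the kernel of the projection acts by left multiplications. -/
theorem shearAction_apply (g₁ g₂ : H) (c : Cover A L) (u : FreeGroup Bool) (w : Wreath A L) :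
    shearAction A L g₁ g₂ c (u, w) =
      ((shearAction A L g₁ g₂ c (1, w)).1 * u, proj A L c * w) := by
  induction c using Cover.induction_on generalizing u w with
  | of i k =>
    cases i
    · rw [shearAction_factorHom_false, shearAction_factorHom_false, proj_factorHom]
      simp [mul_assoc]
    · rw [shearAction_factorHom_true, shearAction_factorHom_true, proj_factorHom]
      simp
  | mul x y hx hy =>
    rw [map_mul, Equiv.Perm.mul_apply, Equiv.Perm.mul_apply, hy u w, hy 1 w, hx, hx (_ * 1)]
    simp [mul_assoc]

/-- The homomorphism from the kernel of the projection to a free group. -/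
noncomputable def kerHom (g₁ g₂ : H) : (proj A L).ker →* FreeGroup Bool :=
  MonoidHom.mk' (fun n => (shearAction A L g₁ g₂ n (1, 1)).1) fun m n => by
    have hn : proj A L n = 1 := n.2
    rw [Subgroup.coe_mul, map_mul, Equiv.Perm.mul_apply,
      shearAction_apply g₁ g₂ (n : Cover A L) 1 1, shearAction_apply g₁ g₂ (m : Cover A L), hn]
    simp

theorem kerHom_eq_one {g₁ g₂ : H} {n : (proj A L).ker}
    (hn : (n : Cover A L) ∈ (shearAction A L g₁ g₂).ker) : kerHom g₁ g₂ n = 1 := by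
  change (shearAction A L g₁ g₂ n (1, 1)).1 = 1
  rw [MonoidHom.mem_ker.1 hn]
  rfl

open scoped commutatorElement

/-- The copy of `B` at the base point shears only over `w.right ∈ L`, its conjugate by `g` only over
`w.right ∈ g L`, and these cosets are disjoint. Over each of them, the element that does not shear
alters a coordinate the weight ignores. -/
theorem relSubgroup_le_ker_shearAction {g₁ g₂ g : H} (hg : g ∉ L)
    (h₁ : ¬ (simSetoid L).r g g₁) (h₂ : ¬ (simSetoid L).r g g₂) :
    relSubgroup A L g ≤ (shearAction A L g₁ g₂).ker := by
  apply Subgroup.normalClosure_le_normal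
  rintro _ ⟨b, b', rfl⟩
  change shearAction A L g₁ g₂ ⁅single A L g b, ofB A L b'⁆ = 1
  have hdc : ∀ k : H, ¬ (simSetoid L).r g k → g ∉ DoubleCoset.doubleCoset k (L : Set H) L ∧
      g⁻¹ ∉ DoubleCoset.doubleCoset k (L : Set H) L := by
    refine fun k hk => ⟨fun h => hk (Or.inl h), fun h => hk (Or.inr ?_)⟩
    obtain ⟨x, hx, y, hy, hxy⟩ := DoubleCoset.mem_doubleCoset.1 h
    refine DoubleCoset.mem_doubleCoset.2 ⟨y⁻¹, inv_mem hy, x⁻¹, inv_mem hx, ?_⟩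
    rw [← inv_inv g, hxy]
    group
  have hg' : g⁻¹ ∉ L := fun h => hg (by simpa using inv_mem h)
  rw [map_commutatorElement, commutatorElement_eq_one_iff_mul_comm]
  refine Equiv.ext fun ⟨u, w⟩ => ?_
  rw [Equiv.Perm.mul_apply, Equiv.Perm.mul_apply, shearAction_single, shearAction_ofB,
    shearAction_single, shearAction_ofB]
  have hw := wreathSingle_mul_comm (A := A) (mk_ne_basePt hg) b b'
  refine Prod.ext ?_ (by simp only [← mul_assoc, hw])
  dsimp only
  by_cases hL : w.right ∈ L
  · have hL' : g⁻¹ * w.right ∉ L := fun h => hg' ((Subgroup.mul_mem_cancel_right _ hL).1 h)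
    have e1 : ∀ v : Wreath A L, v.right = w.right →
        weight g₁ g₂ (SemidirectProduct.inr g⁻¹ * v) = 1 := by
      intro v hv
      refine weight_of_right_notMem ?_
      rwa [SemidirectProduct.mul_right, hv]
    have e2 : ∀ v : Wreath A L, v.right = w.right →
        weight g₁ g₂ (wreathSingle A L 1 b * (SemidirectProduct.inr g⁻¹ * v)) = 1 := by
      intro v hv
      refine weight_of_right_notMem ?_
      rwa [wreathSingle_mul_right, SemidirectProduct.mul_right, hv]
    rw [e1 _ rfl, e2 _ rfl, e1 _ (wreathSingle_mul_right _ _ _),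
      e2 _ (wreathSingle_mul_right _ _ _), weight_wreathSingle_mul hg (hdc _ h₁).1 (hdc _ h₂).1,
      ← mul_assoc (wreathSingle A L 1 b'), ← hw, mul_assoc,
      weight_wreathSingle_mul hg (hdc _ h₁).1 (hdc _ h₂).1]
    simp
  -- The symmetric case: seen after translation by `g⁻¹`, the copy of `B` at the base point sits at
  -- `g⁻¹`, which also avoids both double cosets.
  · have e1 : ∀ v : Wreath A L, v.right = w.right → weight g₁ g₂ v = 1 :=
      fun v hv => weight_of_right_notMem (by rwa [hv])
    have hw' := wreathSingle_mul_comm (A := A) (mk_ne_basePt hg') b' b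
    rw [e1 w rfl, e1 (wreathSingle A L 1 b' * w) (wreathSingle_mul_right _ _ _),
      e1 (wreathSingle A L g b * w) (wreathSingle_mul_right _ _ _),
      e1 (wreathSingle A L 1 b' * (wreathSingle A L g b * w))
        ((wreathSingle_mul_right _ _ _).trans (wreathSingle_mul_right _ _ _)),
      ← mul_assoc (SemidirectProduct.inr g⁻¹), inr_mul_wreathSingle, mul_one, mul_assoc,
      ← mul_assoc (wreathSingle A L 1 b), ← hw', mul_assoc,
      weight_wreathSingle_mul hg' (hdc _ h₁).2 (hdc _ h₂).2,
      weight_wreathSingle_mul hg' (hdc _ h₁).2 (hdc _ h₂).2]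
    simp

/-! ### Values on commutators, independence and free quotients -/

theorem weight_wreathSingle_of_notMem {g₁ g₂ g : H} (hg : g ∉ L) (b : B) :
    weight g₁ g₂ (wreathSingle A L g b) = 1 := by
  refine if_neg fun h => h.2 ?_
  rw [wreathSingle_left_of_ne (mk_ne_basePt hg).symm]
  exact A.one_mem

theorem weight_wreathSingle_one {g₁ g₂ : H} (h₁ : g₁ ∉ L) (h₂ : g₂ ∉ L) (b : B) :
    weight g₁ g₂ (wreathSingle A L 1 b) = 1 := by
  have hr : (wreathSingle A L 1 b).right = 1 := rfl
  rw [weight, hr, one_mul, one_mul, wreathSingle_left_of_ne (mk_ne_basePt h₁),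
    wreathSingle_left_of_ne (mk_ne_basePt h₂)]
  simp [A.one_mem]

theorem weight_one {g₁ g₂ : H} : weight g₁ g₂ (1 : Wreath A L) = 1 :=
  if_neg fun h => h.2 A.one_mem

theorem kerHom_commutator {g₁ g₂ g : H} (h₁ : g₁ ∉ L) (h₂ : g₂ ∉ L) (hg : g ∉ L) (b b' : B)
    {n : (proj A L).ker} (hn : ⁅(single A L g b)⁻¹, (ofB A L b')⁻¹⁆ = (n : Cover A L)) :
    kerHom g₁ g₂ n = (weight g₁ g₂ (wreathSingle A L 1 b' * wreathSingle A L g b))⁻¹ := by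
  have hnp : proj A L n = 1 := n.2
  have hg' : g⁻¹ ∉ L := fun h => hg (by simpa using inv_mem h)
  -- With `s`, `t` the two elements and `n = ⁅s⁻¹, t⁻¹⁆`, evaluate `t * s * n = s * t` at `(1, 1)`.
  -- The right side meets only trivial weights; on the left only the weight of the product survives.
  have h := congrArg (fun c => (shearAction A L g₁ g₂ c (1, 1)).1)
    (show ofB A L b' * single A L g b * n = single A L g b * ofB A L b' by
      rw [← hn, commutatorElement_def]; group)
  have e1 : ∀ v : Wreath A L, v.right = 1 →
      weight g₁ g₂ (SemidirectProduct.inr g⁻¹ * v) = 1 := by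
    intro v hv
    refine weight_of_right_notMem ?_
    rwa [SemidirectProduct.mul_right, hv, SemidirectProduct.right_inr, mul_one]
  have e2 : ∀ v : Wreath A L, v.right = 1 →
      weight g₁ g₂ (wreathSingle A L 1 b * (SemidirectProduct.inr g⁻¹ * v)) = 1 := by
    intro v hv
    refine weight_of_right_notMem ?_
    rwa [wreathSingle_mul_right, SemidirectProduct.mul_right, hv, SemidirectProduct.right_inr,
      mul_one]
  simp only [map_mul, Equiv.Perm.mul_apply] at h
  rw [shearAction_apply g₁ g₂ (n : Cover A L), hnp, shearAction_single, shearAction_ofB,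
    shearAction_ofB, shearAction_single] at h
  dsimp only at h
  simp only [mul_one] at h
  have e3 := e1 1 rfl
  have e4 := e2 1 rfl
  rw [mul_one] at e3 e4
  rw [e1 _ rfl, e2 _ rfl, e3, e4, weight_wreathSingle_of_notMem hg,
    weight_wreathSingle_one h₁ h₂, weight_one] at h
  simp only [inv_one, one_mul, mul_one] at h
  exact eq_inv_of_mul_eq_one_right h

/-- Use one `b ∉ A` at the base point and at `g₁`, respectively `g₂`. In the second case distinct
points are needed because `weight` tests `g₁` first. -/
theorem exists_mem_relSubgroup_kerHom_eq (hAB : A ≠ ⊤) {g₁ g₂ : H} (h₁ : g₁ ∉ L) (h₂ : g₂ ∉ L) :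
    (∃ n : (proj A L).ker, (n : Cover A L) ∈ relSubgroup A L g₁ ∧
      kerHom g₁ g₂ n = (FreeGroup.of true)⁻¹) ∧
    ((g₁ : H ⧸ L) ≠ g₂ → ∃ n : (proj A L).ker, (n : Cover A L) ∈ relSubgroup A L g₂ ∧
      kerHom g₁ g₂ n = (FreeGroup.of false)⁻¹) := by
  obtain ⟨b, hb⟩ : ∃ b, b ∉ A := by
    by_contra! h
    exact hAB (eq_top_iff.2 fun b _ => h b)
  have hmem : ∀ g, ⁅(single A L g b)⁻¹, (ofB A L b)⁻¹⁆ ∈ relSubgroup A L g := by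
    intro g
    refine Subgroup.subset_normalClosure ⟨b⁻¹, b⁻¹, ?_⟩
    change _ = ⁅single A L g b⁻¹, ofB A L b⁻¹⁆
    rw [single_inv, ← ofBHom_apply b⁻¹, map_inv]
    rfl
  have hleft : ∀ g, g ∉ L →
      (wreathSingle A L 1 b * wreathSingle A L g b).left (basePt L) = b := by
    intro g hg
    rw [wreathSingle_mul_left, wreathSingle_left_same,
      wreathSingle_left_of_ne (mk_ne_basePt hg).symm, mul_one]
  have hleft' : ∀ g k, k ∉ L → (wreathSingle A L 1 b * wreathSingle A L g b).left
      ((k : H) : H ⧸ L) = (wreathSingle A L g b).left ((k : H) : H ⧸ L) := by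
    intro g k hk
    rw [wreathSingle_mul_left, wreathSingle_left_of_ne (mk_ne_basePt hk), one_mul]
  have hright : ∀ g, (wreathSingle A L 1 b * wreathSingle A L g b).right = 1 := fun g => one_mul _
  refine ⟨⟨⟨_, relSubgroup_le_ker h₁ (hmem g₁)⟩, hmem g₁, ?_⟩,
    fun hne => ⟨⟨_, relSubgroup_le_ker h₂ (hmem g₂)⟩, hmem g₂, ?_⟩⟩
  · rw [kerHom_commutator h₁ h₂ h₁ b b rfl, weight, hright, hleft _ h₁, one_mul, one_mul,
      hleft' _ _ h₁, wreathSingle_left_same, if_pos ⟨L.one_mem, hb⟩, if_pos hb]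
  · rw [kerHom_commutator h₁ h₂ h₂ b b rfl, weight, hright, hleft _ h₂, one_mul, one_mul,
      hleft' _ _ h₁, hleft' _ _ h₂, wreathSingle_left_same, wreathSingle_left_of_ne hne,
      if_pos ⟨L.one_mem, hb⟩, if_neg (not_not.2 A.one_mem), if_pos hb]

/-- No `relFamily A L i` lies in the subgroup generated by the others. -/
theorem not_relFamily_le_iSup (hAB : A ≠ ⊤) (i : QStar L) :
    ¬ relFamily A L i ≤ ⨆ (j) (_ : j ≠ i), relFamily A L j := by
  obtain ⟨⟨g⟩, hg⟩ := i
  intro h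
  have hgL : g ∉ L := fun h => hg (mk_eq_mk_one_iff.2 h)
  -- With `g₁ = g₂ = g` the action kills every class except that of `g`.
  obtain ⟨⟨n, hn, hn'⟩, -⟩ := exists_mem_relSubgroup_kerHom_eq hAB hgL hgL
  have hle : ⨆ (j) (_ : j ≠ ⟨Quotient.mk _ g, hg⟩), relFamily A L j ≤
      (shearAction A L g g).ker := by
    refine iSup₂_le ?_
    rintro ⟨⟨k⟩, hk⟩ hkg
    have hkg' : ¬ (simSetoid L).r k g := fun hr =>
      hkg (Subtype.ext (Quotient.sound (s := simSetoid L) hr))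
    exact relSubgroup_le_ker_shearAction (fun h => hk (mk_eq_mk_one_iff.2 h)) hkg' hkg'
  rw [kerHom_eq_one (hle (h hn))] at hn'
  exact FreeGroup.of_ne_one true (inv_eq_one.1 hn'.symm)

/-- If two members of `relFamily` are not killed, the kernel has a free quotient of rank two. -/
theorem exists_kerHom_surjective (hAB : A ≠ ⊤) {S : Set (QStar L)} {i j : QStar L} (hi : i ∉ S)
    (hj : j ∉ S) (hij : i ≠ j) : ∃ f : (proj A L).ker →* FreeGroup Bool, Function.Surjective f ∧
      ∀ n : (proj A L).ker, (n : Cover A L) ∈ ⨆ k ∈ S, relFamily A L k → f n = 1 := by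
  obtain ⟨⟨g₁⟩, hg₁⟩ := i
  obtain ⟨⟨g₂⟩, hg₂⟩ := j
  have h₁ : g₁ ∉ L := fun h => hg₁ (mk_eq_mk_one_iff.2 h)
  have h₂ : g₂ ∉ L := fun h => hg₂ (mk_eq_mk_one_iff.2 h)
  have hne : (g₁ : H ⧸ L) ≠ g₂ := by
    intro hc
    refine hij (Subtype.ext (Quotient.sound (s := simSetoid L) (Or.inl ?_)))
    refine DoubleCoset.mem_doubleCoset.2
      ⟨1, L.one_mem, g₂⁻¹ * g₁, QuotientGroup.eq.1 hc.symm, by group⟩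
  obtain ⟨⟨m, -, hm⟩, hn⟩ := exists_mem_relSubgroup_kerHom_eq hAB h₁ h₂
  obtain ⟨n, -, hn⟩ := hn hne
  refine ⟨kerHom g₁ g₂, ?_, fun n hn => kerHom_eq_one ?_⟩
  · rw [← MonoidHom.range_eq_top, eq_top_iff, ← FreeGroup.closure_range_of, Subgroup.closure_le]
    rintro _ ⟨_ | _, rfl⟩
    · exact ⟨n⁻¹, by rw [map_inv, hn, inv_inv]⟩
    · exact ⟨m⁻¹, by rw [map_inv, hm, inv_inv]⟩
  · refine (iSup₂_le ?_ : ⨆ k ∈ S, relFamily A L k ≤ (shearAction A L g₁ g₂).ker) hn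
    rintro ⟨⟨k⟩, hk⟩ hkS
    refine relSubgroup_le_ker_shearAction (fun h => hk (mk_eq_mk_one_iff.2 h)) ?_ ?_
    · exact fun hr => hi ((Subtype.ext (Quotient.sound (s := simSetoid L) hr) :
        (⟨Quotient.mk _ k, hk⟩ : QStar L) = ⟨Quotient.mk _ g₁, hg₁⟩) ▸ hkS)
    · exact fun hr => hj ((Subtype.ext (Quotient.sound (s := simSetoid L) hr) :
        (⟨Quotient.mk _ k, hk⟩ : QStar L) = ⟨Quotient.mk _ g₂, hg₂⟩) ▸ hkS)

/-- A class in `Q` consists of at most two double cosets, those of `g` and `g⁻¹`. -/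
theorem infinite_qStar [Infinite (DoubleCoset.Quotient (L : Set H) (L : Set H))] :
    Infinite (QStar L) := by
  by_contra hfin
  rw [not_infinite_iff_finite] at hfin
  have hQ : Finite (Q L) := by
    refine Set.finite_univ_iff.1 (((Set.finite_singleton (Quotient.mk (simSetoid L) 1)).union
      (Set.finite_range (Subtype.val : QStar L → Q L))).subset fun q _ => ?_)
    by_cases hq : q = Quotient.mk (simSetoid L) 1
    · exact Or.inl hq
    · exact Or.inr ⟨⟨q, hq⟩, rfl⟩
  have hsurj : Function.Surjective fun p : Q L × Bool =>
      DoubleCoset.mk L L (if p.2 then p.1.out else p.1.out⁻¹) := by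
    intro d
    induction d using Quotient.inductionOn with
    | h g =>
      have h1 : (simSetoid L).r g (Quotient.mk (simSetoid L) g).out :=
        (simSetoid L).symm (Quotient.mk_out (s := simSetoid L) g)
      rcases h1 with h1 | h1
      · exact ⟨(Quotient.mk _ g, true), DoubleCoset.mk_eq_of_doubleCoset_eq
          (DoubleCoset.doubleCoset_eq_of_mem h1).symm⟩
      · exact ⟨(Quotient.mk _ g, false), DoubleCoset.mk_eq_of_doubleCoset_eq
          (DoubleCoset.doubleCoset_eq_of_mem h1).symm⟩
  exact not_finite_iff_infinite.2 ‹_› (Finite.of_surjective _ hsurj)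

end SemirestrictedWreath

/-! ### Compactly presented covers -/

theorem IsCompactlyPresented.of_injective {P : Type w} [Group P] [TopologicalSpace P]
    (hP : IsLCGroup P) {X : Type w} {i : X → P} (hi : Function.Injective i)
    (hc : IsCompact (Set.range i)) (hgen : Subgroup.closure (Set.range i) = ⊤) {n : ℕ}
    {R : Set (FreeGroup X)}
    (hR : ∀ r ∈ R, ∃ l : List (X × Bool), l.length ≤ n ∧ FreeGroup.mk l = r)
    (hker : Subgroup.normalClosure R = (FreeGroup.lift i).ker) : IsCompactlyPresented P := by
  refine ⟨hP, Set.range i, hc, hgen, n, ?_⟩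
  let e := Equiv.ofInjective i hi
  let E := FreeGroup.freeGroupCongr e
  refine ⟨E '' R, ?_, ?_⟩
  · rintro _ ⟨r, hr, rfl⟩
    obtain ⟨l, hl, rfl⟩ := hR r hr
    exact ⟨l.map fun x => (e x.1, x.2), by simpa using hl, rfl⟩
  · have h1 : (FreeGroup.lift (fun k : Set.range i => (k : P))).comp E.toMonoidHom =
        FreeGroup.lift i := by
      ext x
      simp [E, e]
    have h2 := Subgroup.map_normalClosure R E.toMonoidHom E.surjective
    rw [hker, ← h1] at h2
    refine h2.symm.trans ?_
    rw [← MonoidHom.comap_ker]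
    exact Subgroup.map_comap_eq_self_of_surjective (f := E.toMonoidHom) E.surjective _

section ShortRelators

variable {G : Type w} [Group G] (K : Set G)

/-- The relators of length at most four between elements of `K`. -/
def shortRelators : Set (FreeGroup K) :=
  {r | FreeGroup.lift (fun k : K => (k : G)) r = 1 ∧
    ∃ l : List (K × Bool), l.length ≤ 4 ∧ FreeGroup.mk l = r}

/-- The projection of the group presented by the short relators between elements of `K`. -/
def shortProj : PresentedGroup (shortRelators K) →* G :=
  PresentedGroup.toGroup (f := fun k : K => (k : G)) fun _ hr => hr.1

open Classical in
/-- The section of `shortProj` over `K`, extended by `1`. -/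
noncomputable def shortSection (u : G) : PresentedGroup (shortRelators K) :=
  if h : u ∈ K then PresentedGroup.of ⟨u, h⟩ else 1

variable {K}

theorem shortSection_of_mem {u : G} (h : u ∈ K) :
    shortSection K u = PresentedGroup.of ⟨u, h⟩ := dif_pos h

theorem shortProj_shortSection {u : G} (h : u ∈ K) : shortProj K (shortSection K u) = u := by
  rw [shortSection_of_mem h]
  exact PresentedGroup.toGroup.of _

/-- This explains the bound four: both multiplicativity and conjugation `k * u = v * k` are
relations of this shape. -/
theorem shortSection_mul_eq {a b c d : G} (ha : a ∈ K) (hb : b ∈ K) (hc : c ∈ K) (hd : d ∈ K)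
    (h : a * b = c * d) :
    shortSection K a * shortSection K b = shortSection K c * shortSection K d := by
  rw [shortSection_of_mem ha, shortSection_of_mem hb, shortSection_of_mem hc,
    shortSection_of_mem hd, ← mul_inv_eq_one]
  refine (QuotientGroup.eq_one_iff (N := Subgroup.normalClosure (shortRelators K))
    (FreeGroup.of ⟨a, ha⟩ * FreeGroup.of ⟨b, hb⟩ *
      (FreeGroup.of ⟨c, hc⟩ * FreeGroup.of ⟨d, hd⟩)⁻¹)).2 (Subgroup.subset_normalClosure ⟨?_,
      [(⟨a, ha⟩, true), (⟨b, hb⟩, true), (⟨d, hd⟩, false), (⟨c, hc⟩, false)], by simp, rfl⟩)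
  simp [h]

theorem shortSection_one (h1 : (1 : G) ∈ K) : shortSection K 1 = 1 := by
  rw [shortSection_of_mem h1]
  refine (QuotientGroup.eq_one_iff (N := Subgroup.normalClosure (shortRelators K))
    (FreeGroup.of ⟨1, h1⟩)).2 (Subgroup.subset_normalClosure ⟨?_, [(⟨1, h1⟩, true)], by simp, rfl⟩)
  simp

theorem shortSection_mul (h1 : (1 : G) ∈ K) {a b : G} (ha : a ∈ K) (hb : b ∈ K)
    (hab : a * b ∈ K) : shortSection K (a * b) = shortSection K a * shortSection K b := by
  have := shortSection_mul_eq hab h1 ha hb (mul_one _)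
  rwa [shortSection_one h1, mul_one] at this

variable [TopologicalSpace G] [IsTopologicalGroup G]

/-- Equivariance is checked for letters of `K` and their inverses, where it is a relation of length
four, and passes to products by continuity of conjugation at `1`. -/
theorem isLocalSection_shortSection (hK : K ∈ 𝓝 (1 : G)) :
    IsLocalSection (shortProj K) (shortSection K) := by
  have h1 := mem_of_mem_nhds hK
  have hconj : ∀ g : G, Tendsto (fun u => g * u * g⁻¹) (𝓝 1) (𝓝 1) := by
    intro g
    have : Continuous fun u : G => g * u * g⁻¹ := by fun_prop
    simpa using this.tendsto 1
  refine ⟨shortSection_one h1, ?_, fun g => ?_, ?_⟩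
  · have hmul : Tendsto (fun z : G × G => z.1 * z.2) (𝓝 1 ×ˢ 𝓝 1) (𝓝 1) := by
      rw [← nhds_prod_eq]
      exact tendsto_mul.trans (by simp)
    filter_upwards [prod_mem_prod hK hK, hmul hK] with z hz hz'
    exact shortSection_mul h1 hz.1 hz.2 hz'
  · obtain ⟨g, rfl⟩ := QuotientGroup.mk'_surjective _ g
    change ∀ᶠ u in 𝓝 1, PresentedGroup.mk _ g * shortSection K u * (PresentedGroup.mk _ g)⁻¹ =
      shortSection K (shortProj K (PresentedGroup.mk _ g) * u *
        (shortProj K (PresentedGroup.mk _ g))⁻¹)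
    induction g using FreeGroup.induction_on with
    | C1 => simp
    | of k =>
      have hk : PresentedGroup.mk (shortRelators K) (FreeGroup.of k) = shortSection K k :=
        (shortSection_of_mem k.2).symm
      rw [hk, shortProj_shortSection k.2]
      filter_upwards [hK, hconj k hK] with u hu hu'
      rw [mul_inv_eq_iff_eq_mul]
      exact shortSection_mul_eq k.2 hu hu' k.2 (by group)
    | inv_of k _ =>
      have hk : PresentedGroup.mk (shortRelators K) (FreeGroup.of k) = shortSection K k :=
        (shortSection_of_mem k.2).symm
      rw [map_inv, hk, map_inv, shortProj_shortSection k.2]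
      filter_upwards [hK, hconj (k : G)⁻¹ hK] with u hu hu'
      rw [mul_inv_eq_iff_eq_mul, inv_mul_eq_iff_eq_mul, ← mul_assoc, eq_mul_inv_iff_mul_eq]
      exact shortSection_mul_eq hu k.2 k.2 hu' (by group)
    | mul x y hx hy =>
      filter_upwards [hy, (hconj (shortProj K (PresentedGroup.mk _ y))).eventually hx] with u hu hu'
      rw [map_mul, map_mul, mul_inv_rev, mul_inv_rev,
        show ∀ a b c : PresentedGroup (shortRelators K), a * b * c * (b⁻¹ * a⁻¹) =
          a * (b * c * b⁻¹) * a⁻¹ from fun a b c => by group, hu, hu']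
      simp only [mul_assoc]
  · filter_upwards [hK] with u hu
    exact shortProj_shortSection hu

end ShortRelators

theorem exists_isCompactlyPresented_cover {G : Type w} [Group G] [TopologicalSpace G]
    (hG : IsCGLCGroup G) : ∃ (P : Type w) (_ : Group P) (_ : TopologicalSpace P) (π : P →* G),
      IsCompactlyPresented P ∧ IsOpenQuotientMap π ∧ DiscreteTopology π.ker := by
  have := hG.isTopologicalGroup
  have := hG.locallyCompactSpace
  obtain ⟨K₀, hK₀, hgen⟩ := hG.compactlyGenerated
  obtain ⟨V, hVc, hV⟩ := exists_compact_mem_nhds (1 : G)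
  let K := K₀ ∪ V
  have hKc : IsCompact K := hK₀.union hVc
  have hK : K ∈ 𝓝 (1 : G) := mem_of_superset hV Set.subset_union_right
  have h1 := mem_of_mem_nhds hK
  have hs := isLocalSection_shortSection hK
  obtain ⟨t, ht, hn⟩ := hs.exists_topology
  have hsurj : Function.Surjective (shortProj K) := by
    rw [← MonoidHom.range_eq_top, eq_top_iff, ← hgen, Subgroup.closure_le]
    exact fun k hk => ⟨_, shortProj_shortSection (Or.inl hk)⟩
  refine ⟨PresentedGroup (shortRelators K), inferInstance, t, shortProj K, ?_,
    ⟨hsurj, hs.continuous hn, hs.isOpenMap hn⟩, hs.discreteTopology_ker hn⟩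
  -- For `v ∈ K` close to `u`, also `u⁻¹ * v ∈ K`, so continuity at `u` reduces to continuity at
  -- `1`. This makes the generating set of the presentation compact.
  have hcont : ContinuousOn (shortSection K) K := by
    intro u hu
    have h2 : Tendsto (fun v => u⁻¹ * v) (𝓝[K] u) (𝓝 1) := by
      have : Continuous fun v : G => u⁻¹ * v := by fun_prop
      have h3 := this.tendsto u
      rw [inv_mul_cancel] at h3
      exact h3.mono_left nhdsWithin_le_nhds
    have h3 : Tendsto (fun v => shortSection K u * shortSection K (u⁻¹ * v)) (𝓝[K] u)
        (𝓝 (shortSection K u * 1)) :=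
      tendsto_const_nhds.mul ((hn ▸ tendsto_map : Tendsto (shortSection K) (𝓝 1) (𝓝 1)).comp h2)
    rw [mul_one] at h3
    refine h3.congr' ?_
    filter_upwards [self_mem_nhdsWithin, h2 hK] with v hv hv'
    rw [← shortSection_mul h1 hu hv' (by rwa [mul_inv_cancel_left]), mul_inv_cancel_left]
  have hrange : Set.range (PresentedGroup.of (rels := shortRelators K)) = shortSection K '' K := by
    ext x
    constructor
    · rintro ⟨k, rfl⟩
      exact ⟨k, k.2, shortSection_of_mem k.2⟩
    · rintro ⟨k, hk, rfl⟩
      exact ⟨⟨k, hk⟩, (shortSection_of_mem hk).symm⟩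
  refine IsCompactlyPresented.of_injective (hs.isLCGroup hG.toIsLCGroup hn)
    (i := PresentedGroup.of (rels := shortRelators K)) ?_ ?_ (PresentedGroup.closure_range_of _)
    (n := 4) (R := shortRelators K) (fun r hr => hr.2) ?_
  · intro k k' hkk
    have h2 := congrArg (shortProj K) hkk
    rw [show shortProj K (PresentedGroup.of k) = (k : G) from PresentedGroup.toGroup.of _,
      show shortProj K (PresentedGroup.of k') = (k' : G) from PresentedGroup.toGroup.of _] at h2
    exact Subtype.ext h2
  · rw [hrange]
    exact hKc.image_of_continuousOn hcont
  · have : FreeGroup.lift (PresentedGroup.of (rels := shortRelators K)) =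
        QuotientGroup.mk' (Subgroup.normalClosure (shortRelators K)) := by
      ext k
      simp [PresentedGroup.of]
      rfl
    rw [this]
    exact (QuotientGroup.ker_mk' _).symm

/-! ### Comparison of covers -/

section Comparison

open scoped Pointwise

theorem IsOpenMap.exists_isCompact_image_superset {X Y : Type*} [TopologicalSpace X]
    [TopologicalSpace Y] [WeaklyLocallyCompactSpace X] {f : X → Y} (hf : IsOpenMap f)
    (hs : Function.Surjective f) {C : Set Y} (hC : IsCompact C) :
    ∃ D : Set X, IsCompact D ∧ C ⊆ f '' D := by
  choose g hg using hs
  choose N hNc hN using fun x : X => exists_compact_mem_nhds x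
  obtain ⟨t, -, ht⟩ := hC.elim_nhds_subcover (fun y => f '' N (g y)) fun y _ => by
    have := hf.image_mem_nhds (hN (g y))
    rwa [hg] at this
  refine ⟨⋃ y ∈ t, N (g y), t.isCompact_biUnion fun y _ => hNc _, ?_⟩
  rwa [Set.image_iUnion₂]

theorem Subgroup.exists_mem_pow_of_mem_closure {G : Type*} [Group G] {K : Set G} {x : G}
    (hx : x ∈ Subgroup.closure K) : ∃ n : ℕ, x ∈ (K ∪ K⁻¹ ∪ {1}) ^ n := by
  induction hx using Subgroup.closure_induction with
  | mem x hx => exact ⟨1, by rw [pow_one]; exact Or.inl (Or.inl hx)⟩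
  | one => exact ⟨0, by simp⟩
  | mul x y _ _ hx hy =>
    obtain ⟨m, hm⟩ := hx
    obtain ⟨n, hn⟩ := hy
    exact ⟨m + n, by rw [pow_add]; exact Set.mul_mem_mul hm hn⟩
  | inv x _ hx =>
    obtain ⟨n, hn⟩ := hx
    refine ⟨n, ?_⟩
    have h1 : (K ∪ K⁻¹ ∪ {1})⁻¹ = K ∪ K⁻¹ ∪ {1} := by
      simp [Set.union_inv, Set.union_comm K]
    rw [← h1, inv_pow]
    simpa using hn

theorem isCompact_pow {M : Type*} [Monoid M] [TopologicalSpace M] [ContinuousMul M] {K : Set M}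
    (hK : IsCompact K) : ∀ n : ℕ, IsCompact (K ^ n)
  | 0 => by
    rw [pow_zero]
    exact isCompact_singleton
  | n + 1 => by
    rw [pow_succ]
    exact (isCompact_pow hK n).mul hK

/-- A compact subset of a Baire group is covered by the image of the words of bounded length in a
compact generating set. -/
theorem exists_pow_image_superset {P G : Type*} [Group P] [TopologicalSpace P]
    [IsTopologicalGroup P] [Group G] [TopologicalSpace G] [IsTopologicalGroup G] [T2Space G]
    [BaireSpace G] {p : P →* G} (hp : Continuous p) (hs : Function.Surjective p) {K : Set P}
    (hK : IsCompact K) (hgen : Subgroup.closure K = ⊤) {C : Set G} (hC : IsCompact C) :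
    ∃ n : ℕ, C ⊆ p '' ((K ∪ K⁻¹ ∪ {1}) ^ n) := by
  set T := K ∪ K⁻¹ ∪ {1} with hT
  have hTc : IsCompact T := (hK.union hK.inv).union isCompact_singleton
  have h1 : (1 : P) ∈ T := Or.inr rfl
  have hcov : ∀ x : P, ∃ n : ℕ, x ∈ T ^ n := fun x =>
    Subgroup.exists_mem_pow_of_mem_closure (hgen ▸ Subgroup.mem_top x)
  -- The sets `p '' T ^ n` are compact, hence closed, and cover `G`; Baire gives one with an
  -- interior point. This replaces openness of `p`, which is not assumed. Translating by words then
  -- handles every point of `G`.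
  obtain ⟨n, y, hy⟩ := nonempty_interior_of_iUnion_of_closed (f := fun n : ℕ => p '' T ^ n)
    (fun n => ((isCompact_pow hTc n).image hp).isClosed) (Set.eq_univ_of_forall fun z => by
      obtain ⟨x, rfl⟩ := hs z
      obtain ⟨n, hn⟩ := hcov x
      exact Set.mem_iUnion.2 ⟨n, x, hn, rfl⟩)
  have hloc : ∀ c : G, ∃ m : ℕ, p '' T ^ m ∈ 𝓝 c := by
    intro c
    obtain ⟨x, hx⟩ := hs (c * y⁻¹)
    obtain ⟨m, hm⟩ := hcov x
    refine ⟨m + n, ?_⟩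
    have h2 : Tendsto (fun z => (c * y⁻¹)⁻¹ * z) (𝓝 c) (𝓝 y) := by
      have : Continuous fun z : G => (c * y⁻¹)⁻¹ * z := by fun_prop
      have h3 := this.tendsto c
      rwa [show (c * y⁻¹)⁻¹ * c = y by group] at h3
    filter_upwards [h2 (mem_interior_iff_mem_nhds.1 hy)] with z hz
    obtain ⟨x', hx', hx''⟩ := hz
    refine ⟨x * x', by rw [pow_add]; exact Set.mul_mem_mul hm hx', ?_⟩
    rw [map_mul, hx, hx'', mul_inv_cancel_left]
  choose m hm using hloc
  obtain ⟨t, -, ht⟩ := hC.elim_nhds_subcover (fun c => p '' T ^ m c) fun c _ => hm c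
  refine ⟨t.sup m, fun c hc => ?_⟩
  obtain ⟨d, hd, x, hx, rfl⟩ := Set.mem_iUnion₂.1 (ht hc)
  exact ⟨x, Set.pow_subset_pow_right h1 (Finset.le_sup hd) hx, rfl⟩

/-- Realises an element of `P` by a word whose lift to the other cover stays in a fixed compact
power. -/
theorem exists_freeGroup_lift_eq_of_mem_pow {P G : Type*} [Group P] [Group G] {K : Set P}
    {s : K → G} {W : Set G} (hs : ∀ k, s k ∈ W) (n : ℕ) {x : P} (hx : x ∈ (K ∪ K⁻¹ ∪ {1}) ^ n) :
    ∃ g : FreeGroup K, FreeGroup.lift (fun k : K => (k : P)) g = x ∧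
      FreeGroup.lift s g ∈ (W ∪ W⁻¹ ∪ {1}) ^ n := by
  induction n generalizing x with
  | zero =>
    rw [pow_zero, Set.mem_one] at hx
    exact ⟨1, by rw [hx, map_one], by rw [map_one, pow_zero]; rfl⟩
  | succ n ih =>
    rw [pow_succ] at hx
    obtain ⟨y, hy, z, hz, rfl⟩ := hx
    obtain ⟨g, rfl, hg⟩ := ih hy
    obtain ⟨k, rfl, hk⟩ : ∃ k : FreeGroup K, FreeGroup.lift (fun k : K => (k : P)) k = z ∧
        FreeGroup.lift s k ∈ W ∪ W⁻¹ ∪ {1} := by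
      rcases hz with (hz | hz) | hz
      · exact ⟨FreeGroup.of ⟨z, hz⟩, by simp, Or.inl (Or.inl (by simpa using hs _))⟩
      · exact ⟨(FreeGroup.of ⟨z⁻¹, hz⟩)⁻¹, by simp, Or.inl (Or.inr (by simpa using hs _))⟩
      · exact ⟨1, by rw [map_one]; exact hz.symm, Or.inr (by simp)⟩
    exact ⟨g * k, map_mul _ _ _, by rw [map_mul, pow_succ]; exact Set.mul_mem_mul hg hk⟩

theorem freeGroup_lift_mk_mem_pow {X G : Type*} [Group G] {s : X → G} {W : Set G}
    (hs : ∀ k, s k ∈ W) {n : ℕ} (l : List (X × Bool)) (hl : l.length ≤ n) :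
    FreeGroup.lift s (FreeGroup.mk l) ∈ (W ∪ W⁻¹ ∪ {1}) ^ n := by
  have h1 : (1 : G) ∈ W ∪ W⁻¹ ∪ {1} := Or.inr rfl
  refine Set.pow_subset_pow_right h1 hl ?_
  clear hl
  rw [FreeGroup.lift_mk]
  induction l with
  | nil => simp
  | cons a l ih =>
    rw [List.map_cons, List.prod_cons, List.length_cons, pow_succ']
    refine Set.mul_mem_mul ?_ ih
    obtain ⟨x, _ | _⟩ := a
    · exact Or.inl (Or.inr (by simpa using hs x))
    · exact Or.inl (Or.inl (hs x))

/-- A compactly presented cover `P` of `G` maps onto every quotient of another cover `E` with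
discrete kernel by a normal subgroup that contains a suitable finite subset of the kernel. -/
theorem IsCompactlyPresented.exists_hom_quotient {P E G : Type*} [Group P] [TopologicalSpace P]
    [Group E] [TopologicalSpace E] [Group G] [TopologicalSpace G] (hP : IsCompactlyPresented P)
    (hE : IsCGLCGroup E) (hG : IsLCGroup G) {p : P →* G} (hp : Continuous p)
    (hps : Function.Surjective p) {π : E →* G} (hπ : IsOpenQuotientMap π)
    (hker : DiscreteTopology π.ker) :
    ∃ Y : Set E, Y.Finite ∧ Y ⊆ π.ker ∧ ∀ (D : Subgroup E) [D.Normal], Y ⊆ D → D ≤ π.ker →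
      ∃ τ : P →* E ⧸ D, Function.Surjective τ ∧ ∀ (x : P) (g : E), τ x = g → π g = p x := by
  have := hP.isTopologicalGroup
  have := hE.isTopologicalGroup
  have := hE.locallyCompactSpace
  have := hE.t2Space
  have := hG.isTopologicalGroup
  have := hG.locallyCompactSpace
  have := hG.t2Space
  obtain ⟨K, hK, hKgen, n, R, hR, hRker⟩ := hP.exists_presentation
  obtain ⟨K₀, hK₀, hK₀gen⟩ := hE.compactlyGenerated
  obtain ⟨W, hW, hKW⟩ := hπ.isOpenMap.exists_isCompact_image_superset hπ.surjective (hK.image hp)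
  obtain ⟨N, hN⟩ := exists_pow_image_superset hp hps hK hKgen (hK₀.image hπ.continuous)
  choose s' hs'W hs using fun k : K => hKW ⟨k, k.2, rfl⟩
  have hs' : ∀ g, π (FreeGroup.lift s' g) = p (FreeGroup.lift (fun k : K => (k : P)) g) := by
    intro g
    have : π.comp (FreeGroup.lift s') = p.comp (FreeGroup.lift (fun k : K => (k : P))) := by
      ext k
      simpa using hs k
    exact DFunLike.congr_fun this g
  set T := W ∪ W⁻¹ ∪ {1}
  have hT : IsCompact T := (hW.union hW.inv).union isCompact_singleton
  -- `T ^ n` contains the lifted relators, which must die for `τ` to exist. `K₀⁻¹ * T ^ N` contains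
  -- the quotients of generators of `E` and lifted words with the same image in `G`; killing these
  -- makes `τ` surjective.
  let C : Set E := T ^ n ∪ K₀⁻¹ * T ^ N
  have hC : IsCompact C := (isCompact_pow hT n).union (hK₀.inv.mul (isCompact_pow hT N))
  have hcl : IsClosed (π.ker : Set E) := Subgroup.isClosed_of_discrete
  refine ⟨C ∩ π.ker, ?_, Set.inter_subset_right, fun D _ hYD hD => ?_⟩
  · have h1 : IsCompact (((↑) : π.ker → E) ⁻¹' C) :=
      hcl.isClosedEmbedding_subtypeVal.isCompact_preimage hC
    have h2 := (h1.finite_of_discrete).image ((↑) : π.ker → E)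
    exact h2.subset fun x hx => ⟨⟨x, hx.2⟩, hx.1, rfl⟩
  let ε := FreeGroup.lift (fun k : K => (k : P))
  have hε : Function.Surjective ε := by
    rw [← MonoidHom.range_eq_top, eq_top_iff, ← hKgen, Subgroup.closure_le]
    exact fun k hk => ⟨FreeGroup.of ⟨k, hk⟩, by simp [ε]⟩
  have hle : ε.ker ≤ ((QuotientGroup.mk' D).comp (FreeGroup.lift s')).ker := by
    rw [← hRker]
    apply Subgroup.normalClosure_le_normal
    intro r hr
    have hr1 : ε r = 1 := by
      have : r ∈ ε.ker := hRker ▸ Subgroup.subset_normalClosure hr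
      exact this
    obtain ⟨l, hl, rfl⟩ := hR r hr
    refine (QuotientGroup.eq_one_iff _).2 (hYD ⟨Or.inl (freeGroup_lift_mk_mem_pow hs'W l hl), ?_⟩)
    change π _ = 1
    rw [hs', show FreeGroup.lift (fun k : K => (k : P)) (FreeGroup.mk l) = 1 from hr1, map_one]
  let τ : P →* E ⧸ D := ε.liftOfSurjective hε ⟨_, hle⟩
  have hτ : ∀ g, τ (ε g) = QuotientGroup.mk' D (FreeGroup.lift s' g) := fun g =>
    MonoidHom.liftOfRightInverse_comp_apply _ _ _ ⟨_, hle⟩ g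
  refine ⟨τ, ?_, ?_⟩
  · rw [← MonoidHom.range_eq_top, eq_top_iff]
    have h1 : (⊤ : Subgroup E) ≤ τ.range.comap (QuotientGroup.mk' D) := by
      rw [← hK₀gen, Subgroup.closure_le]
      intro k hk
      obtain ⟨x, hx, hxk⟩ := hN ⟨k, hk, rfl⟩
      obtain ⟨g, rfl, hg⟩ := exists_freeGroup_lift_eq_of_mem_pow hs'W N hx
      refine ⟨ε g, ?_⟩
      rw [hτ]
      refine (QuotientGroup.eq.2
        (hYD ⟨Or.inr (Set.mul_mem_mul (Set.inv_mem_inv.2 hk) hg), ?_⟩)).symm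
      change π _ = 1
      rw [map_mul, map_inv, hs', hxk, inv_mul_cancel]
    rintro y -
    obtain ⟨x, rfl⟩ := QuotientGroup.mk'_surjective D y
    exact h1 trivial
  · intro x g hxg
    obtain ⟨f, rfl⟩ := hε x
    rw [hτ] at hxg
    have h1 : π ((FreeGroup.lift s' f)⁻¹ * g) = 1 := hD (QuotientGroup.eq.1 hxg)
    rw [map_mul, map_inv, inv_mul_eq_one, hs'] at h1
    exact h1.symm

end Comparison

/-! ### Kernels of compactly presented covers -/

/-- Because of this, the closure in the definition of independence has no effect inside a discrete
kernel. -/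
theorem Subgroup.isClosed_of_le_discrete {G : Type*} [Group G] [TopologicalSpace G]
    [IsTopologicalGroup G] [T2Space G] {D K : Subgroup G} (hD : DiscreteTopology D) (h : K ≤ D) :
    IsClosed (K : Set G) :=
  have : DiscreteTopology K := DiscreteTopology.of_subset hD h
  Subgroup.isClosed_of_discrete

theorem IsOpenQuotientMap.isCompactlyGeneratedGroup {P G : Type*} [Group P] [TopologicalSpace P]
    [Group G] [TopologicalSpace G] {p : P →* G} (hp : IsOpenQuotientMap p)
    (hP : IsCompactlyGeneratedGroup P) : IsCompactlyGeneratedGroup G := by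
  obtain ⟨K, hK, hgen⟩ := hP
  refine ⟨p '' K, hK.image hp.continuous, ?_⟩
  rw [← MonoidHom.map_closure, hgen, ← MonoidHom.range_eq_map,
    MonoidHom.range_eq_top.2 hp.surjective]

theorem Subgroup.exists_finset_subset_iSup {G ι : Type*} [Group G] {N : ι → Subgroup G} {Y : Set G}
    (hY : Y.Finite) (h : Y ⊆ (⨆ i, N i : Subgroup G)) :
    ∃ S : Finset ι, Y ⊆ (⨆ i ∈ S, N i : Subgroup G) := by
  classical
  have hmono : ∀ S T : Finset ι, S ⊆ T → ⨆ i ∈ S, N i ≤ ⨆ i ∈ T, N i := fun S T hST =>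
    biSup_mono fun i hi => hST hi
  have h1 : ∀ y ∈ Y, ∃ S : Finset ι, y ∈ (⨆ i ∈ S, N i : Subgroup G) := by
    intro y hy
    have hy' := h hy
    rw [iSup_eq_iSup_finset] at hy'
    exact (Subgroup.mem_iSup_of_directed fun S T =>
      ⟨S ∪ T, hmono _ _ Finset.subset_union_left, hmono _ _ Finset.subset_union_right⟩).1 hy'
  choose! S hS using h1
  refine ⟨hY.toFinset.biUnion S, fun y hy => hmono _ _ ?_ (hS y hy)⟩
  exact Finset.subset_biUnion_of_mem S (hY.mem_toFinset.2 hy)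

section Comparison

variable {P E G : Type*} [Group P] [Group E] [Group G] {p : P →* G} {π : E →* G} {D : Subgroup E}
  [D.Normal] {τ : P →* E ⧸ D}

/-- The hypothesis `h` says, through representatives, that `τ` is a map over `G`; since `D ≤ π.ker`,
the two kernels over `G` correspond under `τ`. -/
theorem mem_ker_iff_of_hom_quotient (hD : D ≤ π.ker)
    (h : ∀ (x : P) (g : E), τ x = g → π g = p x) (x : P) :
    x ∈ p.ker ↔ τ x ∈ π.ker.map (QuotientGroup.mk' D) := by
  obtain ⟨g, hg⟩ := QuotientGroup.mk'_surjective D (τ x)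
  rw [MonoidHom.mem_ker, ← h x g hg.symm, ← hg]
  constructor
  · exact fun hgk => ⟨g, hgk, rfl⟩
  · rintro ⟨k, hk, hkg⟩
    have h1 : k⁻¹ * g ∈ π.ker := hD (QuotientGroup.eq.1 hkg)
    exact (Subgroup.mul_mem_cancel_left _ (inv_mem hk)).1 h1

theorem exists_surjective_hom_ker {F : Type*} [Group F] (hτ : Function.Surjective τ)
    (hD : D ≤ π.ker) (h : ∀ (x : P) (g : E), τ x = g → π g = p x) {f : π.ker →* F}
    (hf : Function.Surjective f) (hfD : ∀ n : π.ker, (n : E) ∈ D → f n = 1) :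
    ∃ f' : p.ker →* F, Function.Surjective f' := by
  let φ := (QuotientGroup.mk' D).subgroupMap π.ker
  have hφ : Function.Surjective φ := (QuotientGroup.mk' D).subgroupMap_surjective π.ker
  have hle : φ.ker ≤ f.ker := fun n hn =>
    hfD n ((QuotientGroup.eq_one_iff _).1 (congrArg Subtype.val (MonoidHom.mem_ker.1 hn)))
  let f₁ := φ.liftOfSurjective hφ ⟨f, hle⟩
  have hf₁ : ∀ n, f₁ (φ n) = f n := fun n =>
    MonoidHom.liftOfRightInverse_comp_apply _ _ _ ⟨f, hle⟩ n
  let τ₁ : p.ker →* π.ker.map (QuotientGroup.mk' D) := (τ.comp p.ker.subtype).codRestrict _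
    fun x => (mem_ker_iff_of_hom_quotient hD h x).1 x.2
  refine ⟨f₁.comp τ₁, fun y => ?_⟩
  obtain ⟨n, rfl⟩ := hf y
  obtain ⟨x, hx⟩ := hτ (φ n : E ⧸ D)
  have hxk : x ∈ p.ker := by
    rw [mem_ker_iff_of_hom_quotient hD h, hx]
    exact (φ n).2
  refine ⟨⟨x, hxk⟩, ?_⟩
  rw [← hf₁]
  exact congrArg f₁ (Subtype.ext hx)

end Comparison

/-- The kernel of a compactly presented cover of `G` is generated by an infinite independent family
if this holds for some compactly generated cover of `G`. -/
theorem IsCompactlyPresented.isInfinitelyIndependentlyGenerated_ker {P E G : Type (max u v)}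
    [Group P] [TopologicalSpace P] [Group E] [TopologicalSpace E] [Group G] [TopologicalSpace G]
    (hP : IsCompactlyPresented P) (hE : IsCGLCGroup E) (hG : IsLCGroup G) {p : P →* G}
    (hp : Continuous p) (hps : Function.Surjective p) (hpk : DiscreteTopology p.ker) {π : E →* G}
    (hπ : IsOpenQuotientMap π) (hker : DiscreteTopology π.ker) {ι : Type v} [Infinite ι]
    {N : ι → Subgroup E} (hN : ∀ i, (N i).Normal) (hsup : ⨆ i, N i = π.ker)
    (hind : ∀ i, ¬ N i ≤ ⨆ (j) (_ : j ≠ i), N j) :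
    IsInfinitelyIndependentlyGenerated p.ker := by
  have := hP.isTopologicalGroup
  have := hP.t2Space
  obtain ⟨Y, hY, hYk, hYD⟩ := hP.exists_hom_quotient hE hG hp hps hπ hker
  obtain ⟨S, hS⟩ := Subgroup.exists_finset_subset_iSup hY (hsup ▸ hYk)
  let D := ⨆ i ∈ S, N i
  have hDn : D.Normal := inferInstance
  have hDk : D ≤ π.ker := hsup ▸ iSup₂_le fun i _ => le_iSup N i
  obtain ⟨τ, hτ, h⟩ := hYD D hS hDk
  -- The members indexed by `S` become trivial modulo `D` and are dropped. `ULift` only adjusts the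
  -- universe of the index type.
  let M : ULift.{u} {i // i ∉ S} → Subgroup P := fun i =>
    ((N i.down).map (QuotientGroup.mk' D)).comap τ
  have hmapM : ∀ i, (M i).map τ = (N i.down).map (QuotientGroup.mk' D) := fun i =>
    Subgroup.map_comap_eq_self_of_surjective hτ _
  have hMk : ∀ i, M i ≤ p.ker := fun i x hx =>
    (mem_ker_iff_of_hom_quotient hDk h x).2
      (Subgroup.map_mono (hsup ▸ le_iSup N i.down) hx)
  have hinf : Infinite {i // i ∉ S} := (S.finite_toSet.infinite_compl).to_subtype
  refine ⟨ULift.{u} {i // i ∉ S}, M, inferInstance, ⟨fun i => ?_, fun i => ?_, fun i => ?_⟩,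
    le_antisymm (iSup_le hMk) ?_⟩
  · have := (hN i.down).map (QuotientGroup.mk' D) (QuotientGroup.mk'_surjective D)
    exact this.comap τ
  · exact Subgroup.isClosed_of_le_discrete hpk (hMk i)
  · rw [(Subgroup.isClosed_of_le_discrete hpk (iSup₂_le fun j _ => hMk j)).closure_eq]
    intro hle
    have h1 : (M i).map τ ≤ (⨆ (j) (_ : j ≠ i), M j : Subgroup P).map τ := Subgroup.map_mono hle
    simp only [Subgroup.map_iSup, hmapM] at h1
    have h2 : (N i.down).map (QuotientGroup.mk' D) ≤
        (⨆ (j) (_ : j ≠ (i.down : ι)), N j).map (QuotientGroup.mk' D) := by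
      refine h1.trans (iSup₂_le fun j hj => Subgroup.map_mono ?_)
      exact le_iSup₂_of_le (j.down : ι) (fun hji => hj (ULift.ext _ _ (Subtype.ext hji))) le_rfl
    rw [Subgroup.map_le_iff_le_comap, Subgroup.comap_map_eq, QuotientGroup.ker_mk'] at h2
    -- Lifting the inclusion from `E ⧸ D` to `E` adds `D`, which is harmless: its constituents have
    -- indices in `S`, hence different from `i`.
    refine hind i.down (h2.trans (sup_le le_rfl (iSup₂_le fun j hj => ?_)))
    refine le_iSup₂_of_le (f := fun j (_ : j ≠ (i.down : ι)) => N j) j ?_ le_rfl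
    rintro rfl
    exact i.down.2 hj
  · intro x hx
    have h1 : τ x ∈ (⨆ i, M i).map τ := by
      have hle : π.ker.map (QuotientGroup.mk' D) ≤ (⨆ i, M i).map τ := by
        rw [← hsup, Subgroup.map_iSup]
        refine iSup_le fun i => ?_
        by_cases hi : i ∈ S
        · rw [Subgroup.map_le_iff_le_comap]
          intro g hg
          have : QuotientGroup.mk' D g = 1 :=
            (QuotientGroup.eq_one_iff g).2 (le_iSup₂ (f := fun i (_ : i ∈ S) => N i) i hi hg)
          rw [Subgroup.mem_comap, this]
          exact one_mem _
        · rw [← hmapM ⟨⟨i, hi⟩⟩]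
          exact Subgroup.map_mono (le_iSup M _)
      exact hle ((mem_ker_iff_of_hom_quotient hDk h x).1 hx)
    have h2 : x ∈ ((⨆ i, M i).map τ).comap τ := h1
    rw [Subgroup.comap_map_eq] at h2
    -- Every `M i` contains `τ.ker`, so one index is enough to absorb it.
    obtain ⟨i⟩ := hinf.nonempty
    refine (sup_le le_rfl (le_iSup_of_le ⟨i⟩ fun y hy => ?_) :
      (⨆ i, M i) ⊔ τ.ker ≤ ⨆ i, M i) h2
    change τ y ∈ (N i).map (QuotientGroup.mk' D)
    rw [MonoidHom.mem_ker.1 hy]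
    exact one_mem _

/-! ### The wreath product is INIP and largely related -/

namespace SemirestrictedWreath

variable {B : Type u} {H : Type v} [Group B] [TopologicalSpace B] [IsTopologicalGroup B]
  [LocallyCompactSpace B] [T2Space B] [Group H] [TopologicalSpace H] [IsTopologicalGroup H]
  [LocallyCompactSpace H] [T2Space H] {A : Subgroup B} {L : Subgroup H}

theorem isLCGroup_cover (hAc : IsCompact (A : Set B)) (hA : IsOpen (A : Set B))
    (hL : IsOpen (L : Set H)) : IsLCGroup (Cover A L) :=
  have := isTopologicalGroup_wreath hA hL
  (isLocalSection hA hL).isLCGroup (isLCGroup_wreath hAc hA hL) (nhds_one_cover hA hL)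

omit [LocallyCompactSpace B] [T2Space B] [LocallyCompactSpace H] [T2Space H] in
theorem discreteTopology_ker_proj (hA : IsOpen (A : Set B)) (hL : IsOpen (L : Set H)) :
    DiscreteTopology (proj A L).ker :=
  (isLocalSection hA hL).discreteTopology_ker (nhds_one_cover hA hL)

theorem isIndependentFamily_relFamily (hAc : IsCompact (A : Set B)) (hA : IsOpen (A : Set B))
    (hL : IsOpen (L : Set H)) (hAB : A ≠ ⊤) : IsIndependentFamily (relFamily A L) := by
  have := (isLCGroup_cover hAc hA hL).t2Space
  have hd := discreteTopology_ker_proj hA hL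
  have hle : ∀ i, relFamily A L i ≤ (proj A L).ker := fun i =>
    iSup_relFamily (A := A) (L := L) ▸ le_iSup (relFamily A L) i
  refine ⟨normal_relFamily, fun i => Subgroup.isClosed_of_le_discrete hd (hle i), fun i => ?_⟩
  rw [(Subgroup.isClosed_of_le_discrete hd (iSup₂_le fun j _ => hle j)).closure_eq]
  exact not_relFamily_le_iSup hAB i

theorem isCGLCGroup_cover (hAc : IsCompact (A : Set B)) (hA : IsOpen (A : Set B))
    (hL : IsOpen (L : Set H)) (hB : IsCompactlyGeneratedGroup B)
    (hH : IsCompactlyGeneratedGroup H) : IsCGLCGroup (Cover A L) :=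
  ⟨isLCGroup_cover hAc hA hL, isCompactlyGeneratedGroup_cover hAc hA hB hH⟩

theorem isCGLCGroup_wreath (hAc : IsCompact (A : Set B)) (hA : IsOpen (A : Set B))
    (hL : IsOpen (L : Set H)) (hB : IsCompactlyGeneratedGroup B)
    (hH : IsCompactlyGeneratedGroup H) : IsCGLCGroup (Wreath A L) :=
  ⟨isLCGroup_wreath hAc hA hL, (isOpenQuotientMap_proj hA hL).isCompactlyGeneratedGroup
    (isCompactlyGeneratedGroup_cover hAc hA hB hH)⟩

theorem isINIP_wreath (hAc : IsCompact (A : Set B)) (hA : IsOpen (A : Set B))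
    (hL : IsOpen (L : Set H)) (hAB : A ≠ ⊤)
    [Infinite (DoubleCoset.Quotient (L : Set H) (L : Set H))]
    (hB : IsCompactlyGeneratedGroup B) (hH : IsCompactlyGeneratedGroup H) :
    IsINIP (Wreath A L) := by
  have hG := isCGLCGroup_wreath hAc hA hL hB hH
  have := infinite_qStar (L := L)
  have key : ∀ (P : Type (max u v)) [Group P] [TopologicalSpace P] (π : P →* Wreath A L),
      IsCompactlyPresented P → IsOpenQuotientMap π → DiscreteTopology π.ker →
        IsInfinitelyIndependentlyGenerated π.ker := fun P _ _ π hP hπ hk =>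
    IsCompactlyPresented.isInfinitelyIndependentlyGenerated_ker.{u, v} hP
      (isCGLCGroup_cover hAc hA hL hB hH) hG.toIsLCGroup hπ.continuous hπ.surjective hk
      (isOpenQuotientMap_proj hA hL) (discreteTopology_ker_proj hA hL) normal_relFamily
      iSup_relFamily (not_relFamily_le_iSup hAB)
  obtain ⟨P, _, _, π, hP, hπ, hk⟩ := exists_isCompactlyPresented_cover hG
  exact ⟨hG, ⟨P, _, _, π, hP, hπ, hk, key P π hP hπ hk⟩, key⟩

theorem isLargelyRelated_wreath (hAc : IsCompact (A : Set B)) (hA : IsOpen (A : Set B))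
    (hL : IsOpen (L : Set H)) (hAB : A ≠ ⊤)
    [Infinite (DoubleCoset.Quotient (L : Set H) (L : Set H))]
    (hB : IsCompactlyGeneratedGroup B) (hH : IsCompactlyGeneratedGroup H) :
    IsLargelyRelated (Wreath A L) := by
  have hG := isCGLCGroup_wreath hAc hA hL hB hH
  have := infinite_qStar (L := L)
  refine ⟨hG, fun P _ _ p hP hp hps _ => ?_⟩
  obtain ⟨Y, hY, hYk, hYD⟩ := hP.exists_hom_quotient (isCGLCGroup_cover hAc hA hL hB hH)
    hG.toIsLCGroup hp hps (isOpenQuotientMap_proj hA hL) (discreteTopology_ker_proj hA hL)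
  obtain ⟨S, hS⟩ := Subgroup.exists_finset_subset_iSup (N := relFamily A L) hY
    (iSup_relFamily (A := A) (L := L) ▸ hYk)
  have hDk : ⨆ i ∈ S, relFamily A L i ≤ (proj A L).ker :=
    iSup_relFamily (A := A) (L := L) ▸ iSup₂_le fun i _ => le_iSup (relFamily A L) i
  have hn := normal_relFamily (A := A) (L := L)
  obtain ⟨τ, hτ, h⟩ := hYD (⨆ i ∈ S, relFamily A L i) hS hDk
  -- Two classes outside `S` survive modulo the join over `S` and provide the two free generators.
  obtain ⟨i, hi, j, hj, hij⟩ := S.finite_toSet.infinite_compl.nontrivial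
  obtain ⟨f, hf, hfD⟩ := exists_kerHom_surjective hAB hi hj hij
  obtain ⟨f', hf'⟩ := exists_surjective_hom_ker hτ hDk h hf hfD
  exact ⟨Bool, f', inferInstance, hf'⟩

end SemirestrictedWreath

theorem proposition5 {B : Type u} {H : Type v}
    [Group B] [TopologicalSpace B] [IsTopologicalGroup B] [LocallyCompactSpace B] [T2Space B]
    [Group H] [TopologicalSpace H] [IsTopologicalGroup H] [LocallyCompactSpace H] [T2Space H]
    (A : Subgroup B) (hAcompact : IsCompact (A : Set B)) (hAopen : IsOpen (A : Set B))
    (L : Subgroup H) (hLopen : IsOpen (L : Set H)) (hAB : A ≠ ⊤) :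
    (IsLCGroup (SemirestrictedWreath.Cover A L) ∧
      IsOpenQuotientMap (SemirestrictedWreath.proj A L) ∧
      DiscreteTopology (SemirestrictedWreath.proj A L).ker ∧
      ⨆ q, SemirestrictedWreath.relFamily A L q = (SemirestrictedWreath.proj A L).ker ∧
      IsIndependentFamily (SemirestrictedWreath.relFamily A L)) ∧
    (Infinite (DoubleCoset.Quotient (L : Set H) (L : Set H)) →
      IsCompactlyGeneratedGroup B → IsCompactlyGeneratedGroup H →
        IsINIP (SemirestrictedWreath.Wreath A L) ∧
        IsLargelyRelated (SemirestrictedWreath.Wreath A L)) := by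
  open SemirestrictedWreath in
  exact ⟨⟨isLCGroup_cover hAcompact hAopen hLopen, isOpenQuotientMap_proj hAopen hLopen,
    discreteTopology_ker_proj hAopen hLopen, iSup_relFamily,
    isIndependentFamily_relFamily hAcompact hAopen hLopen hAB⟩, fun _ hB hH =>
    ⟨isINIP_wreath hAcompact hAopen hLopen hAB hB hH,
      isLargelyRelated_wreath hAcompact hAopen hLopen hAB hB hH⟩⟩
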